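/- Throughout, $d\ge 2$ is an integer, and a tube $T\subset\mathbb R^d$ of width $w(T)>0$ is the open $w(T)/2$-neighbourhood of a line in $\mathbb R^d$. A set $E\subset\mathbb R^d$ is called $Q$-Ahlfors regular, where $0<Q\le d$, if there is a constant $C>0$ such that $r^Q/C\le \mathcal H^Q(E\cap B(x,r))\le C r^Q$ for all $x\in E$ and all $0<r<\operatorname{diam}(E)$; here $\mathcal H^Q$ is the $Q$-dimensional Hausdorff measure and $B(x,r)$ the closed ball. **Random Cantor sets with $M_n=2$, $N_n=2^{d-1}$.** Let $E_0=[0,1]^d$. Given $E_n$, a union of $2^{(d-1)n}$ retained closed dyadic cubes of side $2^{-n}$, choose, conditionally independently inside each of the retained cubes, a random collection of $2^{d-1}$ of its $2^d$ closed dyadic subcubes of side $2^{-n-1}$, in such a way that each of the $2^d$ subcubes is chosen with the same conditional probability $1/2$ given $E_n$ (the joint law of the chosen collection is otherwise arbitrary). Let $E_{n+1}$ be the union of all chosen subcubes, and $E=\bigcap_{n} E_n$. **Theorem.** For every $d\ge 2$ there is a compact $(d-1)$-Ahlfors regular set $E\subset\mathbb R^d$ with $0<\mathcal H^{d-1}(E)<\infty$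 such that, for every $0\le t<d-1$, $$\sup_T \frac{\mathcal H^{d-1}(E\cap T)}{w(T)^t}<\infty ,$$ where the supremum is over all tubes $T$ in $\mathbb R^d$. Moreover, $E$ can be taken to be a realization of a random Cantor set with $M_n=2$ and $N_n=2^{d-1}$; and for every such random Cantor set, almost surely, the limit set has all of these properties (for all $0\le t<d-1$ simultaneously). -/

import Mathlib

open MeasureTheory ProbabilityTheory
open scoped ENNReal

/-! ### Tubes and Ahlfors regularity -/

/-- A line: an affine subspace of dimension one. -/
def IsLine {d : ℕ} (L : AffineSubspace ℝ (EuclideanSpace ℝ (Fin d))) : Prop :=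
  Module.finrank ℝ L.direction = 1

/-- The tube of width `w` around `L`: the (open) `w / 2`-neighbourhood of `L`. -/
def tube {d : ℕ} (L : AffineSubspace ℝ (EuclideanSpace ℝ (Fin d))) (w : ℝ) :
    Set (EuclideanSpace ℝ (Fin d)) :=
  Metric.thickening (w / 2) (L : Set (EuclideanSpace ℝ (Fin d)))

/-- The supremum of `H^s (E ∩ T) / w(T) ^ t` over all tubes `T` of positive width. -/
noncomputable def tubeSup {d : ℕ} (s t : ℝ) (E : Set (EuclideanSpace ℝ (Fin d))) : ℝ≥0∞ :=
  ⨆ (L : AffineSubspace ℝ (EuclideanSpace ℝ (Fin d))) (_ : IsLine L) (w : ℝ) (_ : 0 < w),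
    μH[s] (E ∩ tube L w) / ENNReal.ofReal (w ^ t)

/-- `Q`-Ahlfors regularity of a subset of `ℝ^d`, for `0 < Q ≤ d`. -/
def IsAhlforsRegular {d : ℕ} (Q : ℝ) (E : Set (EuclideanSpace ℝ (Fin d))) : Prop :=
  0 < Q ∧ Q ≤ d ∧ ∃ C : ℝ, 0 < C ∧ ∀ x ∈ E, ∀ r : ℝ, 0 < r → ENNReal.ofReal r < Metric.ediam E →
    ENNReal.ofReal (r ^ Q / C) ≤ μH[Q] (E ∩ Metric.closedBall x r) ∧
      μH[Q] (E ∩ Metric.closedBall x r) ≤ ENNReal.ofReal (C * r ^ Q)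

/-- `E` is a compact `(d-1)`-Ahlfors regular set of positive and finite `(d-1)`-dimensional
Hausdorff measure, and for every `0 ≤ t < d - 1` the ratios `H^{d-1} (E ∩ T) / w(T) ^ t` are
bounded over all tubes `T`. -/
structure IsTubeBounded {d : ℕ} (E : Set (EuclideanSpace ℝ (Fin d))) : Prop where
  isCompact : IsCompact E
  ahlfors : IsAhlforsRegular ((d : ℝ) - 1) E
  hausdorff_pos : 0 < μH[(d : ℝ) - 1] E
  hausdorff_lt_top : μH[(d : ℝ) - 1] E < ⊤
  tubeSup_lt_top : ∀ t : ℝ, 0 ≤ t → t < (d : ℝ) - 1 → tubeSup ((d : ℝ) - 1) t E < ⊤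

/-! ### The dyadic random Cantor sets -/

/-- A choice of `2 ^ (d - 1)` of the `2 ^ d` dyadic children of a cube. A child is coded by its
position `e : Fin d → Fin 2` (lower or upper half in every coordinate). -/
def CubeChoice (d : ℕ) : Type := {A : Finset (Fin d → Fin 2) // A.card = 2 ^ (d - 1)}

instance cubeChoiceMeasurableSpace (d : ℕ) : MeasurableSpace (CubeChoice d) := ⊤

/-- The closed dyadic cube of side `2 ^ (-n)` with lower corner `2 ^ (-n) • k`. -/
def dyadicCube {d : ℕ} (n : ℕ) (k : Fin d → ℕ) : Set (EuclideanSpace ℝ (Fin d)) :=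
  {x | ∀ i, (k i : ℝ) / 2 ^ n ≤ x i ∧ x i ≤ ((k i : ℝ) + 1) / 2 ^ n}

/-- A choice of children for every dyadic cube `dyadicCube n k`. Only the choices made at cubes
that are retained in the construction matter. -/
abbrev Selection (d : ℕ) : Type := ℕ → (Fin d → ℕ) → CubeChoice d

/-- The cubes of side `2 ^ (-n)` retained after `n` steps, starting from the unit cube. The child
of the cube `k` at position `e` is the cube `2 k + e` of the next level. -/
def retained {d : ℕ} (S : Selection d) : ℕ → Finset (Fin d → ℕ)
  | 0 => {0}
  | n + 1 => (retained S n).biUnion fun k =>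
      (S n k).1.image fun e i => 2 * k i + (e i : ℕ)

/-- `E_n`, the union of the retained cubes of level `n`. -/
def cantorStage {d : ℕ} (S : Selection d) (n : ℕ) : Set (EuclideanSpace ℝ (Fin d)) :=
  ⋃ k ∈ retained S n, dyadicCube n k

/-- The limit set `E = ⋂ E_n`. -/
def limitCantorSet {d : ℕ} (S : Selection d) : Set (EuclideanSpace ℝ (Fin d)) :=
  ⋂ n, cantorStage S n

/-- The random choices `X ω` on the probability space `(Ω, P)` drive a random Cantor set with
`M_n = 2` and `N_n = 2 ^ (d - 1)`: given the retained cubes of level `n` (equivalently, given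
`E_n`, which determines all earlier stages), the choices inside them are independent, and in each
of them every child is chosen with the same probability `2 ^ (d - 1) / 2 ^ d = 1 / 2`. The joint
law of the choice inside one cube is otherwise arbitrary. -/
structure IsRandomCantor {d : ℕ} {Ω : Type*} [MeasurableSpace Ω] (P : Measure Ω)
    (X : Ω → Selection d) : Prop where
  isProbabilityMeasure : IsProbabilityMeasure P
  measurable : ∀ n k, Measurable fun ω => X ω n k
  indep : ∀ (n : ℕ) (K : Finset (Fin d → ℕ)), P {ω | retained (X ω) n = K} ≠ 0 →
    iIndepFun (fun (k : K) (ω : Ω) => X ω n k) (P[|{ω | retained (X ω) n = K}])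
  marginal : ∀ (n : ℕ) (K : Finset (Fin d → ℕ)), P {ω | retained (X ω) n = K} ≠ 0 →
    ∀ k ∈ K, ∀ e : Fin d → Fin 2,
      P[|{ω | retained (X ω) n = K}] {ω | e ∈ (X ω n k).1} = 1 / 2

/-!
The measure `H^{d-1}` of the part of the limit set in a set `A` is at most a constant times
`2 ^ (-(d - 1) * m)` times the number of retained cubes of level `m` that meet `A`
(`hausdorffMeasure_inter_le`), because every retained cube has exactly `2 ^ (d - 1)` retained
children. Together with the mass distribution principle for the natural measure
(`naturalMeasure_le_hausdorffMeasure`) this gives compactness, Ahlfors regularity and positive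
finite measure for every selection, without any randomness.

Randomness enters only through the count of the retained cubes of level `m` in a tube of width
`2 ^ (-m)`. Up to constants there are only `2 ^ O(m)` such tubes inside the unit cube: each is
covered by one of the discrete tubes `discreteTube m i a b` with integer parameters of size `O(2 ^ m)`
(`IsLine.exists_discreteTube`). For a fixed discrete tube `F` let `Y_n` be the conditional
expectation, given the `n`-th stage, of the number of retained cubes of level `m` in `F`. This is a
martingale. As `F` has `O(2 ^ j)` members in a cube of level `m - j`, every cube contributes a
bounded amount to `Y_n`, so that the conditional variance of `Y_{n+1}` is `O(Y_n)`. This yields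
`E exp (θ * Y_{n+1}) ≤ E exp (θ * (1 + O(θ)) * Y_n)`, and with `θ` of order `1 / n` at level `n` the
loss telescopes: `E exp (c * Y_m / (m + 1)) ≤ exp (1 / 2)`
(`IsRandomCantor.lintegral_exp_card_le`). Markov's inequality makes `Y_m ≥ C * (m + 1) ^ 2`
so unlikely that a union bound over all discrete tubes and the Borel-Cantelli lemma apply
(`IsRandomCantor.ae_eventually_card_discreteTube_lt`). Hence almost surely
`H^{d-1} (E ∩ T) = O(m ^ 2 * 2 ^ (-(d - 1) * m))` for all tubes `T` of width about `2 ^ (-m)`, which is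
`O(w(T) ^ t)` for every `t < d - 1`.
-/

/-! ### The combinatorics of the retained cubes -/

/-- The address of the child of the cube `k` at position `e`. -/
def childCube {d : ℕ} (k : Fin d → ℕ) (e : Fin d → Fin 2) : Fin d → ℕ :=
  fun i => 2 * k i + (e i : ℕ)

/-- The address of the cube `j` generations above the cube `k`. -/
def ancestor {d : ℕ} (j : ℕ) (k : Fin d → ℕ) : Fin d → ℕ := fun i => k i / 2 ^ j

@[simp] lemma ancestor_zero {d : ℕ} (k : Fin d → ℕ) : ancestor 0 k = k := by
  ext i; simp [ancestor]

lemma ancestor_childCube {d : ℕ} (j : ℕ) (k : Fin d → ℕ) (e : Fin d → Fin 2) :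
    ancestor (j + 1) (childCube k e) = ancestor j k := by
  ext i
  have h := (e i).isLt
  have : (2 * k i + (e i : ℕ)) / 2 = k i := by omega
  simp only [ancestor, childCube, pow_succ', ← Nat.div_div_eq_div_mul, this]

lemma ancestor_one_childCube {d : ℕ} (k : Fin d → ℕ) (e : Fin d → Fin 2) :
    ancestor 1 (childCube k e) = k := by
  simpa using ancestor_childCube 0 k e

lemma childCube_inj {d : ℕ} {k k' : Fin d → ℕ} {e e' : Fin d → Fin 2}
    (h : childCube k e = childCube k' e') : k = k' ∧ e = e' := by
  have hk : k = k' := by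
    rw [← ancestor_one_childCube k e, h, ancestor_one_childCube]
  subst hk
  refine ⟨rfl, funext fun i => Fin.ext ?_⟩
  have := congrFun h i
  simp only [childCube] at this
  omega

lemma childCube_inj_iff {d : ℕ} {k k' : Fin d → ℕ} {e e' : Fin d → Fin 2} :
    childCube k e = childCube k' e' ↔ k = k' ∧ e = e' :=
  ⟨childCube_inj, fun h => by rw [h.1, h.2]⟩

lemma exists_childCube_eq {d : ℕ} (k : Fin d → ℕ) : ∃ e, k = childCube (ancestor 1 k) e := by
  refine ⟨fun i => ⟨k i % 2, Nat.mod_lt _ two_pos⟩, funext fun i => ?_⟩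
  simp only [childCube, ancestor]
  omega

lemma ancestor_succ {d : ℕ} (j : ℕ) (k : Fin d → ℕ) :
    ancestor (j + 1) k = ancestor 1 (ancestor j k) := by
  ext i
  simp only [ancestor, Nat.div_div_eq_div_mul, pow_succ, pow_zero, one_mul]

lemma retained_succ {d : ℕ} (S : Selection d) (n : ℕ) :
    retained S (n + 1) = (retained S n).biUnion fun k => (S n k).1.image (childCube k) := rfl

lemma sum_retained_succ {d : ℕ} {M : Type*} [AddCommMonoid M] (S : Selection d) (n : ℕ)
    (f : (Fin d → ℕ) → M) :
    ∑ k ∈ retained S (n + 1), f k =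
      ∑ k ∈ retained S n, ∑ e ∈ (S n k).1, f (childCube k e) := by
  rw [retained_succ, Finset.sum_biUnion]
  · refine Finset.sum_congr rfl fun k _ => ?_
    rw [Finset.sum_image]
    intro e _ e' _ h
    exact (childCube_inj h).2
  · intro k _ k' _ hkk'
    rw [Function.onFun, Finset.disjoint_left]
    intro a ha ha'
    obtain ⟨e, _, rfl⟩ := Finset.mem_image.1 ha
    obtain ⟨e', _, h⟩ := Finset.mem_image.1 ha'
    exact hkk' (childCube_inj h).1.symm

lemma mem_retained_succ {d : ℕ} {S : Selection d} {n : ℕ} {k : Fin d → ℕ} :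
    k ∈ retained S (n + 1) ↔ ∃ k' ∈ retained S n, ∃ e ∈ (S n k').1, childCube k' e = k := by
  simp [retained_succ]

lemma ancestor_mem_retained {d : ℕ} {S : Selection d} {n : ℕ} (j : ℕ) {k : Fin d → ℕ}
    (hk : k ∈ retained S (n + j)) : ancestor j k ∈ retained S n := by
  induction j generalizing k with
  | zero => simpa using hk
  | succ j ih =>
    obtain ⟨k', hk', e, _, rfl⟩ := mem_retained_succ.1 hk
    rw [ancestor_childCube]
    exact ih hk'

lemma lt_of_mem_retained {d : ℕ} {S : Selection d} {n : ℕ} {k : Fin d → ℕ}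
    (hk : k ∈ retained S n) (i : Fin d) : k i < 2 ^ n := by
  induction n generalizing k with
  | zero => simp only [retained, Finset.mem_singleton] at hk; simp [hk]
  | succ n ih =>
    obtain ⟨k', hk', e, _, rfl⟩ := mem_retained_succ.1 hk
    have := ih hk'
    have h := (e i).isLt
    simp only [childCube, pow_succ]
    omega

/-- Every retained cube of level `n` has exactly `2 ^ ((d - 1) * j)` retained descendants of level
`n + j`. -/
lemma card_filter_ancestor {d : ℕ} (S : Selection d) (n j : ℕ) {B : Finset (Fin d → ℕ)}
    (hB : B ⊆ retained S n) :
    ((retained S (n + j)).filter fun k => ancestor j k ∈ B).card = (2 ^ (d - 1)) ^ j * B.card := by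
  induction j with
  | zero =>
    have : (retained S n).filter (fun k => k ∈ B) = B := by
      ext k; simpa using fun h => hB h
    simp [this]
  | succ j ih =>
    rw [Finset.card_filter, ← add_assoc, sum_retained_succ]
    simp only [ancestor_childCube, Finset.sum_const, (S (n + j) _).2, smul_eq_mul]
    rw [← Finset.mul_sum, ← Finset.card_filter, ih, pow_succ', mul_assoc]

lemma card_retained {d : ℕ} (S : Selection d) (n : ℕ) :
    (retained S n).card = (2 ^ (d - 1)) ^ n := by
  have h := card_filter_ancestor S 0 n (B := retained S 0) subset_rfl
  rw [Finset.filter_true_of_mem fun k hk => ancestor_mem_retained n hk] at h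
  simpa [retained] using h

lemma dyadicCube_subset_ancestor {d : ℕ} (n j : ℕ) (k : Fin d → ℕ) :
    dyadicCube (n + j) k ⊆ dyadicCube n (ancestor j k) := by
  intro x hx i
  obtain ⟨h1, h2⟩ := hx i
  have hj : (0 : ℝ) < 2 ^ j := by positivity
  have hn : (0 : ℝ) < 2 ^ n := by positivity
  have e1 : ((k i / 2 ^ j : ℕ) : ℝ) * 2 ^ j ≤ k i := by
    exact_mod_cast Nat.div_mul_le_self (k i) (2 ^ j)
  have e2 : (k i : ℝ) + 1 ≤ (((k i / 2 ^ j : ℕ) : ℝ) + 1) * 2 ^ j := by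
    exact_mod_cast Nat.lt_div_mul_add (a := k i) (b := 2 ^ j) (by positivity) |>.trans_eq (by ring)
  rw [pow_add, div_le_iff₀ (by positivity)] at h1
  rw [pow_add, le_div_iff₀ (by positivity)] at h2
  simp only [ancestor]
  rw [div_le_iff₀ hn, le_div_iff₀ hn]
  constructor
  · exact le_of_mul_le_mul_right (by linarith) hj
  · exact le_of_mul_le_mul_right (by linarith) hj

lemma isClosed_dyadicCube {d : ℕ} (n : ℕ) (k : Fin d → ℕ) : IsClosed (dyadicCube n k) := by
  have : dyadicCube n k = ⋂ i, (fun x : EuclideanSpace ℝ (Fin d) => x i) ⁻¹'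
      Set.Icc ((k i : ℝ) / 2 ^ n) (((k i : ℝ) + 1) / 2 ^ n) := by
    ext x; simp [dyadicCube]
  rw [this]
  exact isClosed_iInter fun i => isClosed_Icc.preimage (by fun_prop)

lemma dist_le_of_mem_dyadicCube {d : ℕ} {n : ℕ} {k : Fin d → ℕ} {x y : EuclideanSpace ℝ (Fin d)}
    (hx : x ∈ dyadicCube n k) (hy : y ∈ dyadicCube n k) : dist x y ≤ d / 2 ^ n := by
  have hn : (0 : ℝ) < 2 ^ n := by positivity
  have h : ∀ i, (dist (x i) (y i)) ^ 2 ≤ (1 / 2 ^ n) ^ 2 := fun i => by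
    have hx := hx i
    have hy := hy i
    rw [add_div] at hx hy
    refine pow_le_pow_left₀ dist_nonneg ?_ 2
    rw [Real.dist_eq, abs_le]
    constructor <;> linarith
  rw [EuclideanSpace.dist_eq, Real.sqrt_le_left (by positivity)]
  calc ∑ i, dist (x i) (y i) ^ 2 ≤ ∑ _i : Fin d, ((1 : ℝ) / 2 ^ n) ^ 2 :=
        Finset.sum_le_sum fun i _ => h i
    _ = d * (1 / 2 ^ n) ^ 2 := by simp
    _ ≤ (d : ℝ) ^ 2 * (1 / 2 ^ n) ^ 2 := by
        gcongr
        exact_mod_cast Nat.le_self_pow two_ne_zero d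
    _ = _ := by ring

lemma ediam_dyadicCube_le {d : ℕ} (n : ℕ) (k : Fin d → ℕ) :
    Metric.ediam (dyadicCube n k) ≤ ENNReal.ofReal (d / 2 ^ n) := by
  refine Metric.ediam_le fun x hx y hy => ?_
  rw [edist_dist]
  exact ENNReal.ofReal_le_ofReal (dist_le_of_mem_dyadicCube hx hy)

lemma isClosed_limitCantorSet {d : ℕ} (S : Selection d) : IsClosed (limitCantorSet S) :=
  isClosed_iInter fun n => (retained S n).finite_toSet.isClosed_biUnion
    fun k _ => isClosed_dyadicCube n k

lemma exists_mem_retained {d : ℕ} {S : Selection d} {x : EuclideanSpace ℝ (Fin d)}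
    (hx : x ∈ limitCantorSet S) (n : ℕ) : ∃ k ∈ retained S n, x ∈ dyadicCube n k := by
  simpa [limitCantorSet, cantorStage] using Set.mem_iInter.1 hx n

lemma limitCantorSet_subset {d : ℕ} (S : Selection d) : limitCantorSet S ⊆ dyadicCube 0 0 := by
  intro x hx
  obtain ⟨k, hk, hxk⟩ := exists_mem_retained hx 0
  simp only [retained, Finset.mem_singleton] at hk
  rwa [hk] at hxk

lemma isCompact_limitCantorSet {d : ℕ} (S : Selection d) : IsCompact (limitCantorSet S) := by
  refine Metric.isCompact_of_isClosed_isBounded (isClosed_limitCantorSet S) ?_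
  refine Bornology.IsBounded.subset ?_ (limitCantorSet_subset S)
  exact Metric.isBounded_iff.2 ⟨d / 2 ^ 0, fun x hx y hy => dist_le_of_mem_dyadicCube hx hy⟩

/-! ### Upper bounds for the Hausdorff measure -/

open Classical in
/-- The retained cubes of level `m` that meet `A`. -/
noncomputable def retainedMeeting {d : ℕ} (S : Selection d) (m : ℕ)
    (A : Set (EuclideanSpace ℝ (Fin d))) : Finset (Fin d → ℕ) :=
  (retained S m).filter fun k => (dyadicCube m k ∩ A).Nonempty

lemma mem_retainedMeeting {d : ℕ} {S : Selection d} {m : ℕ}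
    {A : Set (EuclideanSpace ℝ (Fin d))} {k : Fin d → ℕ} :
    k ∈ retainedMeeting S m A ↔ k ∈ retained S m ∧ (dyadicCube m k ∩ A).Nonempty := by
  simp [retainedMeeting]

/-- The descendants at a fine level of the `m`-cubes that meet `A` cover `E ∩ A`; since a retained
cube has `2 ^ (d - 1)` retained children, their total `(d - 1)`-dimensional size does not depend on
the fine level. -/
lemma hausdorffMeasure_inter_le {d : ℕ} (S : Selection d) (m : ℕ)
    (A : Set (EuclideanSpace ℝ (Fin d))) :
    μH[((d - 1 : ℕ) : ℝ)] (limitCantorSet S ∩ A) ≤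
      ENNReal.ofReal ((retainedMeeting S m A).card * ((d : ℝ) / 2 ^ m) ^ (d - 1)) := by
  set B := retainedMeeting S m A with hB
  let D : ℕ → Finset (Fin d → ℕ) := fun j => (retained S (m + j)).filter fun k => ancestor j k ∈ B
  have hcard (j : ℕ) : (D j).card = (2 ^ (d - 1)) ^ j * B.card :=
    card_filter_ancestor S m j fun k hk => (mem_retainedMeeting.1 hk).1
  have hr : Filter.Tendsto (fun j : ℕ => ENNReal.ofReal ((d : ℝ) / 2 ^ (m + j))) Filter.atTop
      (nhds 0) := by
    rw [← ENNReal.ofReal_zero]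
    refine ENNReal.tendsto_ofReal ?_
    have h := (tendsto_pow_atTop_nhds_zero_of_lt_one (r := (1 / 2 : ℝ)) (by norm_num)
      (by norm_num)).const_mul ((d : ℝ) / 2 ^ m)
    rw [mul_zero] at h
    refine h.congr fun j => ?_
    rw [pow_add, one_div, inv_pow]
    field_simp
  refine (Measure.hausdorffMeasure_le_liminf_sum (ι := fun j => D j) ((d - 1 : ℕ) : ℝ) _ _ hr
    (fun j k => dyadicCube (m + j) k.1) (Filter.Eventually.of_forall fun j k =>
      ediam_dyadicCube_le _ _) (Filter.Eventually.of_forall fun j x hx => ?_)).trans ?_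
  · obtain ⟨k, hk, hxk⟩ := exists_mem_retained hx.1 (m + j)
    refine Set.mem_iUnion.2 ⟨⟨k, Finset.mem_filter.2 ⟨hk, mem_retainedMeeting.2
      ⟨ancestor_mem_retained j hk, x, dyadicCube_subset_ancestor m j k hxk, hx.2⟩⟩⟩, hxk⟩
  · have hle (j : ℕ) : ∑ k : D j, Metric.ediam (dyadicCube (m + j) k.1) ^ ((d - 1 : ℕ) : ℝ) ≤
        ENNReal.ofReal (B.card * ((d : ℝ) / 2 ^ m) ^ (d - 1)) := by
      calc _ ≤ ∑ _k : D j, ENNReal.ofReal ((d : ℝ) / 2 ^ (m + j)) ^ (d - 1) := by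
            refine Finset.sum_le_sum fun k _ => ?_
            rw [ENNReal.rpow_natCast]
            gcongr
            exact ediam_dyadicCube_le _ _
        _ = ENNReal.ofReal ((D j).card * ((d : ℝ) / 2 ^ (m + j)) ^ (d - 1)) := by
            rw [Finset.sum_const, Finset.card_univ, Fintype.card_coe, nsmul_eq_mul,
              ENNReal.ofReal_mul (by positivity), ENNReal.ofReal_natCast,
              ENNReal.ofReal_pow (by positivity)]
        _ ≤ _ := by
            refine ENNReal.ofReal_le_ofReal (le_of_eq ?_)
            rw [hcard, pow_add]
            push_cast
            rw [← div_div, div_pow _ ((2 : ℝ) ^ j), pow_right_comm (2 : ℝ) (d - 1) j]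
            field_simp
    refine (Filter.liminf_le_liminf (Filter.Eventually.of_forall hle)).trans ?_
    simp

/-- The number of integer points in a cube of side `2 R`. -/
lemma card_le_of_forall_abs_sub_le {d : ℕ} {B : Finset (Fin d → ℕ)} {c : Fin d → ℝ} {R : ℕ}
    (h : ∀ k ∈ B, ∀ i, |(k i : ℝ) - c i| ≤ R) : B.card ≤ (2 * R + 1) ^ d := by
  have hsub : B.image (fun k i => (k i : ℤ)) ⊆
      Fintype.piFinset fun i => Finset.Icc ⌈c i - R⌉ ⌊c i + R⌋ := by
    intro z hz
    obtain ⟨k, hk, rfl⟩ := Finset.mem_image.1 hz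
    simp only [Fintype.mem_piFinset, Finset.mem_Icc, Int.ceil_le, Int.le_floor]
    intro i
    have := abs_le.1 (h k hk i)
    push_cast
    constructor <;> linarith
  have hinj : Function.Injective fun (k : Fin d → ℕ) i => (k i : ℤ) := by
    intro k k' hkk'
    ext i
    simpa using congrFun hkk' i
  calc B.card = (B.image (fun k i => (k i : ℤ))).card := (Finset.card_image_of_injective _ hinj).symm
    _ ≤ _ := Finset.card_le_card hsub
    _ = ∏ i, (⌊c i + R⌋ + 1 - ⌈c i - R⌉).toNat := by simp
    _ ≤ ∏ _i : Fin d, (2 * R + 1) := by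
        refine Finset.prod_le_prod' fun i _ => ?_
        have h1 := Int.floor_le (c i + R)
        have h2 := Int.le_ceil (c i - R)
        have : ((⌊c i + R⌋ - ⌈c i - R⌉ : ℤ) : ℝ) ≤ ((2 * R : ℤ) : ℝ) := by
          push_cast
          linarith
        have := Int.cast_le.1 this
        omega
    _ = _ := by simp

/-- At most boundedly many cubes of level `m` meet a set of diameter comparable to `2 ^ (-m)`. -/
lemma card_retainedMeeting_le {d : ℕ} (S : Selection d) (m R : ℕ)
    {A : Set (EuclideanSpace ℝ (Fin d))} {x : EuclideanSpace ℝ (Fin d)}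
    (hA : ∀ y ∈ A, dist y x ≤ R / 2 ^ m) :
    (retainedMeeting S m A).card ≤ (2 * R + 3) ^ d := by
  have hm : (0 : ℝ) < 2 ^ m := by positivity
  refine card_le_of_forall_abs_sub_le (c := fun i => 2 ^ m * x i) (R := R + 1) fun k hk i => ?_
  obtain ⟨-, y, hy, hyA⟩ := mem_retainedMeeting.1 hk
  have h1 : |y i - x i| ≤ R / 2 ^ m := by
    have := PiLp.norm_apply_le (y - x) i
    rw [← dist_eq_norm] at this
    exact this.trans (hA y hyA)
  have h2 := hy i
  rw [div_le_iff₀ hm, le_div_iff₀ hm] at h2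
  have h3 : |(y i - x i) * 2 ^ m| ≤ R := by
    rw [abs_mul, abs_of_pos hm]
    exact (le_div_iff₀ hm).1 h1
  rw [abs_le] at h3 ⊢
  push_cast
  constructor <;> linarith

/-! ### The natural measure and lower bounds for the Hausdorff measure -/

/-- The member of the choice `A` with number `j`, in some enumeration; `j` is read modulo
`2 ^ (d - 1)`. -/
noncomputable def CubeChoice.get {d : ℕ} (A : CubeChoice d) (j : ℕ) : Fin d → Fin 2 :=
  ((A.1.equivFinOfCardEq A.2).symm ⟨j % 2 ^ (d - 1), Nat.mod_lt _ (by positivity)⟩).1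

lemma CubeChoice.get_mem {d : ℕ} (A : CubeChoice d) (j : ℕ) : A.get j ∈ A.1 :=
  Subtype.coe_prop _

lemma CubeChoice.mod_eq_of_get_eq {d : ℕ} (A : CubeChoice d) {j j' : ℕ} (h : A.get j = A.get j') :
    j % 2 ^ (d - 1) = j' % 2 ^ (d - 1) :=
  Fin.mk.inj_iff.1 ((Equiv.injective _) (Subtype.ext h))

/-- The address of the retained cube of level `n` that is reached by reading the first `n` digits of
`t ∈ [0, 1)` in base `2 ^ (d - 1)`, each digit picking one of the `2 ^ (d - 1)` retained children. -/
noncomputable def digitAddress {d : ℕ} (S : Selection d) (t : ℝ) : ℕ → Fin d → ℕ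
  | 0 => 0
  | n + 1 => childCube (digitAddress S t n)
      ((S n (digitAddress S t n)).get ⌊((2 ^ (d - 1) : ℕ) : ℝ) ^ (n + 1) * t⌋₊)

lemma digitAddress_mem_retained {d : ℕ} (S : Selection d) (t : ℝ) (n : ℕ) :
    digitAddress S t n ∈ retained S n := by
  induction n with
  | zero => simp [digitAddress, retained]
  | succ n ih => exact mem_retained_succ.2 ⟨_, ih, _, CubeChoice.get_mem _ _, rfl⟩

lemma floor_eq_of_digitAddress_eq {d : ℕ} (S : Selection d) {t t' : ℝ}
    (ht : t ∈ Set.Ico (0 : ℝ) 1) (ht' : t' ∈ Set.Ico (0 : ℝ) 1) (n : ℕ)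
    (h : digitAddress S t n = digitAddress S t' n) :
    ⌊((2 ^ (d - 1) : ℕ) : ℝ) ^ n * t⌋₊ = ⌊((2 ^ (d - 1) : ℕ) : ℝ) ^ n * t'⌋₊ := by
  induction n with
  | zero =>
    rw [pow_zero, one_mul, one_mul, Nat.floor_eq_zero.2 ht.2, Nat.floor_eq_zero.2 ht'.2]
  | succ n ih =>
    have hN : ((2 ^ (d - 1) : ℕ) : ℝ) ≠ 0 := by positivity
    have hdiv (u : ℝ) : ⌊((2 ^ (d - 1) : ℕ) : ℝ) ^ (n + 1) * u⌋₊ / 2 ^ (d - 1) =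
        ⌊((2 ^ (d - 1) : ℕ) : ℝ) ^ n * u⌋₊ := by
      rw [← Nat.floor_div_natCast, pow_succ]
      congr 1
      field_simp
    simp only [digitAddress] at h
    obtain ⟨h1, h2⟩ := childCube_inj h
    have h3 := ih h1
    rw [h1] at h2
    have h4 := CubeChoice.mod_eq_of_get_eq _ h2
    rw [← Nat.div_add_mod ⌊((2 ^ (d - 1) : ℕ) : ℝ) ^ (n + 1) * t⌋₊ (2 ^ (d - 1)), h4, hdiv, h3,
      ← hdiv, Nat.div_add_mod]

lemma measurable_digitAddress {d : ℕ} (S : Selection d) (n : ℕ) :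
    Measurable fun t => digitAddress S t n := by
  induction n with
  | zero => exact measurable_const
  | succ n ih =>
    have h : Measurable fun t : ℝ => (digitAddress S t n,
        ⌊((2 ^ (d - 1) : ℕ) : ℝ) ^ (n + 1) * t⌋₊) :=
      ih.prodMk (Nat.measurable_floor.comp (by fun_prop))
    exact (Measurable.of_discrete (f := fun p : (Fin d → ℕ) × ℕ =>
      childCube p.1 ((S n p.1).get p.2))).comp h

lemma measureReal_digitAddress_le {d : ℕ} (S : Selection d) (n : ℕ) (k : Fin d → ℕ) :
    (volume.restrict (Set.Ico (0 : ℝ) 1)).real {t | digitAddress S t n = k} ≤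
      ((2 ^ (d - 1) : ℝ) ^ n)⁻¹ := by
  have hpos : (0 : ℝ) < (2 ^ (d - 1)) ^ n := by positivity
  have hmeas : MeasurableSet {t | digitAddress S t n = k} :=
    measurable_digitAddress S n (measurableSet_singleton k)
  rw [measureReal_restrict_apply hmeas]
  rcases ({t | digitAddress S t n = k} ∩ Set.Ico (0 : ℝ) 1).eq_empty_or_nonempty with h | ⟨u, hu, hu1⟩
  · rw [h]
    simp [hpos.le]
  · set j := ⌊((2 ^ (d - 1) : ℕ) : ℝ) ^ n * u⌋₊ with hj
    have hsub : {t | digitAddress S t n = k} ∩ Set.Ico (0 : ℝ) 1 ⊆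
        Set.Ico (j / (2 ^ (d - 1)) ^ n : ℝ) ((j + 1) / (2 ^ (d - 1)) ^ n) := by
      rintro t ⟨ht, ht1⟩
      have h := floor_eq_of_digitAddress_eq S ht1 hu1 n (ht.trans hu.symm)
      rw [← hj, Nat.floor_eq_iff (by have := ht1.1; positivity)] at h
      push_cast at h
      exact ⟨by rw [div_le_iff₀ hpos]; linarith, by rw [lt_div_iff₀ hpos]; linarith⟩
    refine (measureReal_mono hsub (by simp)).trans (le_of_eq ?_)
    rw [Real.volume_real_Ico_of_le (by gcongr; linarith)]
    ring

lemma measureReal_digitAddress {d : ℕ} (S : Selection d) (n : ℕ) {k : Fin d → ℕ}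
    (hk : k ∈ retained S n) :
    (volume.restrict (Set.Ico (0 : ℝ) 1)).real {t | digitAddress S t n = k} =
      ((2 ^ (d - 1) : ℝ) ^ n)⁻¹ := by
  refine le_antisymm (measureReal_digitAddress_le S n k) (not_lt.1 fun hlt => ?_)
  have huniv : (⋃ k ∈ retained S n, {t | digitAddress S t n = k}) = Set.univ := by
    ext t
    simpa using digitAddress_mem_retained S t n
  have h1 : (1 : ℝ) ≤ ∑ k ∈ retained S n,
      (volume.restrict (Set.Ico (0 : ℝ) 1)).real {t | digitAddress S t n = k} := by
    refine le_trans ?_ (measureReal_biUnion_finset_le _ _)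
    rw [huniv, measureReal_restrict_apply MeasurableSet.univ]
    simp
  have h2 := Finset.sum_lt_sum (fun k _ => measureReal_digitAddress_le S n k) ⟨k, hk, hlt⟩
  rw [Finset.sum_const, card_retained, nsmul_eq_mul] at h2
  push_cast at h2
  rw [mul_inv_cancel₀ (by positivity)] at h2
  linarith

lemma ancestor_digitAddress {d : ℕ} (S : Selection d) (t : ℝ) (n j : ℕ) :
    ancestor j (digitAddress S t (n + j)) = digitAddress S t n := by
  induction j with
  | zero => simp
  | succ j ih => rw [← ih, ← add_assoc, digitAddress, ancestor_childCube]

lemma digitAddress_corner_mem {d : ℕ} (S : Selection d) (t : ℝ) {n m : ℕ} (h : n ≤ m) (i : Fin d) :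
    (digitAddress S t n i : ℝ) / 2 ^ n ≤ digitAddress S t m i / 2 ^ m ∧
      (digitAddress S t m i : ℝ) / 2 ^ m ≤ (digitAddress S t n i + 1) / 2 ^ n := by
  obtain ⟨j, rfl⟩ := Nat.exists_eq_add_of_le h
  have hmem : WithLp.toLp 2 (fun i => (digitAddress S t (n + j) i : ℝ) / 2 ^ (n + j)) ∈
      dyadicCube (n + j) (digitAddress S t (n + j)) := fun i => ⟨le_rfl, by simp; gcongr; linarith⟩
  have := dyadicCube_subset_ancestor n j _ hmem i
  rwa [ancestor_digitAddress] at this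

/-- The point of the limit set with digits `t`: the common point of the cubes `digitAddress S t n`. -/
noncomputable def digitPoint {d : ℕ} (S : Selection d) (t : ℝ) : EuclideanSpace ℝ (Fin d) :=
  WithLp.toLp 2 fun i => ⨆ n, (digitAddress S t n i : ℝ) / 2 ^ n

lemma digitPoint_mem_dyadicCube {d : ℕ} (S : Selection d) (t : ℝ) (n : ℕ) :
    digitPoint S t ∈ dyadicCube n (digitAddress S t n) := by
  intro i
  have hle (m : ℕ) :
      (digitAddress S t m i : ℝ) / 2 ^ m ≤ (digitAddress S t n i + 1) / 2 ^ n := by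
    rcases le_total n m with h | h
    · exact (digitAddress_corner_mem S t h i).2
    · refine (digitAddress_corner_mem S t h i).1.trans ?_
      gcongr
      linarith
  exact ⟨le_ciSup (f := fun n => (digitAddress S t n i : ℝ) / 2 ^ n)
    ⟨_, Set.forall_mem_range.2 hle⟩ n, ciSup_le hle⟩

lemma digitPoint_mem_limitCantorSet {d : ℕ} (S : Selection d) (t : ℝ) :
    digitPoint S t ∈ limitCantorSet S :=
  Set.mem_iInter.2 fun n => Set.mem_biUnion (digitAddress_mem_retained S t n)
    (digitPoint_mem_dyadicCube S t n)

lemma measurable_digitPoint {d : ℕ} (S : Selection d) : Measurable (digitPoint S) := by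
  refine (WithLp.measurable_toLp 2 _).comp (measurable_pi_lambda _ fun i => ?_)
  refine Measurable.iSup fun n => Measurable.div_const ?_ _
  exact (Measurable.of_discrete (f := fun k : Fin d → ℕ => (k i : ℝ))).comp
    (measurable_digitAddress S n)

/-- The natural probability measure on the limit set, which gives the mass `2 ^ (-(d - 1) * n)` to
every retained cube of level `n`. It is the law of `digitPoint S t` for uniform `t ∈ [0, 1)`. -/
noncomputable def naturalMeasure {d : ℕ} (S : Selection d) : Measure (EuclideanSpace ℝ (Fin d)) :=
  (volume.restrict (Set.Ico (0 : ℝ) 1)).map (digitPoint S)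

lemma le_naturalMeasure {d : ℕ} (S : Selection d) {n : ℕ} {k : Fin d → ℕ} (hk : k ∈ retained S n)
    {A : Set (EuclideanSpace ℝ (Fin d))} (hA : MeasurableSet A)
    (hkA : limitCantorSet S ∩ dyadicCube n k ⊆ A) :
    ENNReal.ofReal ((2 ^ (d - 1) : ℝ) ^ n)⁻¹ ≤ naturalMeasure S A := by
  rw [← measureReal_digitAddress S n hk, ofReal_measureReal, naturalMeasure,
    Measure.map_apply (measurable_digitPoint S) hA]
  refine measure_mono fun t ht => hkA ⟨digitPoint_mem_limitCantorSet S t, ?_⟩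
  have := digitPoint_mem_dyadicCube S t n
  rwa [show digitAddress S t n = k from ht] at this

lemma naturalMeasure_le {d : ℕ} (S : Selection d) (n : ℕ) {A : Set (EuclideanSpace ℝ (Fin d))}
    (hA : MeasurableSet A) :
    naturalMeasure S A ≤
      ENNReal.ofReal ((retainedMeeting S n A).card * ((2 ^ (d - 1) : ℝ) ^ n)⁻¹) := by
  rw [naturalMeasure, Measure.map_apply (measurable_digitPoint S) hA]
  have hsub : digitPoint S ⁻¹' A ⊆ ⋃ k ∈ retainedMeeting S n A, {t | digitAddress S t n = k} := by
    intro t ht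
    exact Set.mem_biUnion (x := digitAddress S t n) (mem_retainedMeeting.2
      ⟨digitAddress_mem_retained S t n, _, digitPoint_mem_dyadicCube S t n, ht⟩) rfl
  refine (measure_mono hsub).trans ((measure_biUnion_finset_le _ _).trans ?_)
  rw [ENNReal.ofReal_mul (by positivity), ENNReal.ofReal_natCast, ← nsmul_eq_mul,
    ← Finset.sum_const]
  refine Finset.sum_le_sum fun k _ => ?_
  rw [← ofReal_measureReal]
  exact ENNReal.ofReal_le_ofReal (measureReal_digitAddress_le S n k)

/-- The mass distribution principle for the natural measure. -/
lemma naturalMeasure_le_hausdorffMeasure {d : ℕ} (hd : 2 ≤ d) (S : Selection d) :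
    ENNReal.ofReal ((5 ^ d * 2 ^ (d - 1))⁻¹ : ℝ) • naturalMeasure S ≤ μH[((d - 1 : ℕ) : ℝ)] := by
  refine Measure.le_hausdorffMeasure _ _ 1 one_pos fun s hs => ?_
  rw [Measure.smul_apply, smul_eq_mul, ENNReal.rpow_natCast]
  rcases s.eq_empty_or_nonempty with rfl | ⟨x, hx⟩
  · simp
  have hfin : Metric.ediam s ≠ ⊤ := (hs.trans_lt ENNReal.one_lt_top).ne
  set δ := (Metric.ediam s).toReal with hδ
  have hδ0 : 0 ≤ δ := ENNReal.toReal_nonneg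
  have hδ1 : δ ≤ 1 := by simpa using ENNReal.toReal_mono ENNReal.one_ne_top hs
  have hsδ : Metric.ediam s = ENNReal.ofReal δ := (ENNReal.ofReal_toReal hfin).symm
  have hbound (m : ℕ) (hm : δ ≤ (1 / 2) ^ m) :
      naturalMeasure S s ≤ ENNReal.ofReal (5 ^ d * ((1 / 2) ^ m) ^ (d - 1)) := by
    refine (measure_mono subset_closure).trans
      ((naturalMeasure_le S m isClosed_closure.measurableSet).trans (ENNReal.ofReal_le_ofReal ?_))
    have hc := card_retainedMeeting_le S m 1 (A := closure s) (x := x) fun y hy => by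
      have h1 : edist y x ≤ ENNReal.ofReal δ := by
        rw [← hsδ, ← Metric.ediam_closure]
        exact Metric.edist_le_ediam_of_mem hy (subset_closure hx)
      rw [edist_le_ofReal hδ0] at h1
      simpa using h1.trans hm
    have e : ((2 ^ (d - 1) : ℝ) ^ m)⁻¹ = ((1 / 2) ^ m) ^ (d - 1) := by
      rw [one_div, inv_pow, inv_pow, pow_right_comm]
    rw [e]
    gcongr
    exact_mod_cast hc
  rcases hδ0.eq_or_lt with h0 | h0
  · have hz : naturalMeasure S s ≤ 0 := by
      have ht : Filter.Tendsto (fun m : ℕ => ENNReal.ofReal (5 ^ d * ((1 / 2) ^ m) ^ (d - 1)))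
          Filter.atTop (nhds 0) := by
        rw [← ENNReal.ofReal_zero]
        refine ENNReal.tendsto_ofReal ?_
        have h := ((tendsto_pow_atTop_nhds_zero_of_lt_one (r := (1 / 2 : ℝ)) (by norm_num)
          (by norm_num)).pow (d - 1)).const_mul ((5 : ℝ) ^ d)
        rwa [zero_pow (by omega), mul_zero] at h
      exact ge_of_tendsto' ht fun m => hbound m (by rw [← h0]; positivity)
    simp [nonpos_iff_eq_zero.1 hz]
  · obtain ⟨m, hm1, hm2⟩ := exists_nat_pow_near_of_lt_one h0 hδ1 (y := (1 / 2 : ℝ)) (by norm_num)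
      (by norm_num)
    rw [hsδ, ← ENNReal.ofReal_pow hδ0]
    refine (mul_le_mul_right (hbound m hm2) _).trans ?_
    rw [← ENNReal.ofReal_mul (by positivity)]
    refine ENNReal.ofReal_le_ofReal ?_
    have : ((1 / 2 : ℝ) ^ m) ^ (d - 1) ≤ (2 * δ) ^ (d - 1) := by
      gcongr
      rw [pow_succ] at hm1
      linarith
    rw [mul_pow] at this
    calc _ = (2 ^ (d - 1) : ℝ)⁻¹ * ((1 / 2 : ℝ) ^ m) ^ (d - 1) := by field_simp
      _ ≤ (2 ^ (d - 1) : ℝ)⁻¹ * (2 ^ (d - 1) * δ ^ (d - 1)) := by gcongr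
      _ = _ := by field_simp

/-! ### Ahlfors regularity -/

lemma ediam_limitCantorSet_le {d : ℕ} (S : Selection d) :
    Metric.ediam (limitCantorSet S) ≤ ENNReal.ofReal d := by
  simpa using (Metric.ediam_mono (limitCantorSet_subset S)).trans (ediam_dyadicCube_le 0 0)

lemma hausdorffMeasure_limitCantorSet_lt_top {d : ℕ} (S : Selection d) :
    μH[((d - 1 : ℕ) : ℝ)] (limitCantorSet S) < ⊤ := by
  have := hausdorffMeasure_inter_le S 0 Set.univ
  rw [Set.inter_univ] at this
  exact this.trans_lt ENNReal.ofReal_lt_top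

/-- The part of the limit set in a retained cube of level `n` has `(d - 1)`-dimensional measure at
least of the order `2 ^ (-(d - 1) * n)`. -/
lemma le_hausdorffMeasure_of_inter_dyadicCube_subset {d : ℕ} (hd : 2 ≤ d) (S : Selection d) {n : ℕ}
    {k : Fin d → ℕ} (hk : k ∈ retained S n) {A : Set (EuclideanSpace ℝ (Fin d))}
    (hA : MeasurableSet A) (hkA : limitCantorSet S ∩ dyadicCube n k ⊆ A) :
    ENNReal.ofReal ((5 ^ d * 2 ^ (d - 1))⁻¹ * ((1 / 2) ^ n) ^ (d - 1)) ≤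
      μH[((d - 1 : ℕ) : ℝ)] A := by
  refine le_trans ?_ (naturalMeasure_le_hausdorffMeasure hd S A)
  rw [Measure.smul_apply, smul_eq_mul, ENNReal.ofReal_mul (by positivity)]
  have e : ((1 / 2 : ℝ) ^ n) ^ (d - 1) = ((2 ^ (d - 1) : ℝ) ^ n)⁻¹ := by
    rw [one_div, inv_pow, inv_pow, pow_right_comm]
  rw [e]
  gcongr
  exact le_naturalMeasure S hk hA hkA

lemma hausdorffMeasure_limitCantorSet_pos {d : ℕ} (hd : 2 ≤ d) (S : Selection d) :
    0 < μH[((d - 1 : ℕ) : ℝ)] (limitCantorSet S) := by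
  refine lt_of_lt_of_le ?_ (le_hausdorffMeasure_of_inter_dyadicCube_subset hd S (n := 0) (k := 0)
    (by simp [retained]) (isClosed_limitCantorSet S).measurableSet Set.inter_subset_left)
  rw [ENNReal.ofReal_pos]
  positivity

lemma isAhlforsRegular_limitCantorSet {d : ℕ} (hd : 2 ≤ d) (S : Selection d) :
    IsAhlforsRegular ((d : ℝ) - 1) (limitCantorSet S) := by
  have hcast : (d : ℝ) - 1 = ((d - 1 : ℕ) : ℝ) := by
    rw [Nat.cast_sub (by omega), Nat.cast_one]
  have hd2 : (2 : ℝ) ≤ d := by exact_mod_cast hd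
  refine ⟨by linarith, by linarith, (2 * d + 3) ^ d * 2 ^ (d - 1) +
    5 ^ d * 2 ^ (d - 1) * (2 * d) ^ (d - 1), by positivity, fun x hx r hr hrE => ?_⟩
  have hrd : r < d := by
    have := hrE.trans_le (ediam_limitCantorSet_le S)
    rwa [ENNReal.ofReal_lt_ofReal_iff (by linarith)] at this
  obtain ⟨m, hm1, hm2⟩ := exists_nat_pow_near_of_lt_one (x := r / d) (y := (1 / 2 : ℝ))
    (by positivity) ((div_le_one (by linarith)).2 hrd.le) (by norm_num) (by norm_num)
  rw [hcast, Real.rpow_natCast]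
  constructor
  · obtain ⟨k, hk, hxk⟩ := exists_mem_retained hx (m + 1)
    refine le_trans ?_ (le_hausdorffMeasure_of_inter_dyadicCube_subset hd S hk
      ((isClosed_limitCantorSet S).inter Metric.isClosed_closedBall).measurableSet ?_)
    · refine ENNReal.ofReal_le_ofReal ?_
      rw [div_le_iff₀ (by positivity)]
      have h1 : r ^ (d - 1) ≤ ((2 * d) * (1 / 2) ^ (m + 1)) ^ (d - 1) := by
        gcongr
        rw [div_le_iff₀ (by linarith)] at hm2
        rw [pow_succ]
        linarith
      rw [mul_pow] at h1
      set a : ℝ := ((1 / 2) ^ (m + 1)) ^ (d - 1) with ha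
      have ha0 : 0 ≤ a := by positivity
      calc _ ≤ _ := h1
        _ = (5 ^ d * 2 ^ (d - 1))⁻¹ * a * (5 ^ d * 2 ^ (d - 1) * (2 * d) ^ (d - 1)) := by
            field_simp
        _ ≤ _ := by
            gcongr
            exact le_add_of_nonneg_left (by positivity)
    · refine fun y hy => ⟨hy.1, ?_⟩
      refine (dist_le_of_mem_dyadicCube hy.2 hxk).trans ?_
      rw [lt_div_iff₀ (by linarith), one_div, inv_pow] at hm1
      rw [div_eq_inv_mul]
      exact hm1.le
  · refine (hausdorffMeasure_inter_le S m _).trans (ENNReal.ofReal_le_ofReal ?_)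
    have hc := card_retainedMeeting_le S m d (A := Metric.closedBall x r) (x := x) fun y hy => by
      refine (Metric.mem_closedBall.1 hy).trans ?_
      rw [div_le_iff₀ (by linarith), one_div, inv_pow] at hm2
      rw [div_eq_inv_mul]
      exact hm2
    have h1 : ((d : ℝ) / 2 ^ m) ^ (d - 1) ≤ (2 * r) ^ (d - 1) := by
      gcongr
      rw [lt_div_iff₀ (by linarith), one_div, inv_pow, pow_succ, mul_inv] at hm1
      rw [div_eq_inv_mul]
      linarith
    rw [mul_pow] at h1
    calc _ ≤ ((2 * d + 3) ^ d : ℝ) * (2 ^ (d - 1) * r ^ (d - 1)) := by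
          gcongr
          exact_mod_cast hc
      _ ≤ _ := by
          rw [← mul_assoc]
          gcongr
          exact le_add_of_nonneg_right (by positivity)

/-! ### Discrete tubes -/

open Classical in
/-- A discrete tube at scale `2 ^ (-m)`: the addresses of level `m` within distance `5` in every
coordinate of the line that passes through the integer points `a` and `b` at the values `0` and
`2 ^ m` of the parameter, where the `i`-th coordinate serves as the parameter. -/
noncomputable def discreteTube {d : ℕ} (m : ℕ) (i : Fin d) (a b : Fin d → ℤ) :
    Finset (Fin d → ℕ) :=
  (Fintype.piFinset fun _ => Finset.range (2 ^ m)).filter fun k =>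
    ∀ j, |(k j : ℝ) - (a j + (k i : ℝ) / 2 ^ m * (b j - a j))| ≤ 5

/-- A discrete tube meets every dyadic cube in a number of addresses that is at most proportional
to the side of the cube: for each value of the `i`-th coordinate there are boundedly many. -/
lemma card_filter_discreteTube_le {d : ℕ} (m j : ℕ) (i : Fin d) (a b : Fin d → ℤ)
    (k₀ : Fin d → ℕ) :
    ((discreteTube m i a b).filter fun k => ancestor j k = k₀).card ≤ 11 ^ d * 2 ^ j := by
  have hmap : ∀ k ∈ (discreteTube m i a b).filter (fun k => ancestor j k = k₀),
      k i ∈ Finset.Ico (k₀ i * 2 ^ j) (k₀ i * 2 ^ j + 2 ^ j) := by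
    intro k hk
    rw [← (Finset.mem_filter.1 hk).2]
    exact Finset.mem_Ico.2 ⟨Nat.div_mul_le_self _ _, Nat.lt_div_mul_add (by positivity)⟩
  refine (Finset.card_le_mul_card_image_of_maps_to hmap (11 ^ d) fun v _ => ?_).trans (by simp)
  refine card_le_of_forall_abs_sub_le (R := 5)
    (c := fun l => a l + (v : ℝ) / 2 ^ m * (b l - a l)) fun k hk l => ?_
  obtain ⟨hk1, rfl⟩ := Finset.mem_filter.1 hk
  exact_mod_cast (Finset.mem_filter.1 (Finset.mem_filter.1 hk1).1).2 l

/-- The parameters of the discrete tubes at scale `2 ^ (-m)` that suffice to cover all tubes of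
width at most `2 ^ (-m)` inside the unit cube. -/
noncomputable def tubeParameters (d m : ℕ) : Finset (Fin d × (Fin d → ℤ) × (Fin d → ℤ)) :=
  Finset.univ ×ˢ (Fintype.piFinset fun _ => Finset.Icc (-(6 * 2 ^ m)) (6 * 2 ^ m)) ×ˢ
    (Fintype.piFinset fun _ => Finset.Icc (-(6 * 2 ^ m)) (6 * 2 ^ m))

lemma card_tubeParameters_le (d m : ℕ) :
    (tubeParameters d m).card ≤ d * 2 ^ (2 * d * (m + 4)) := by
  have h1 : ((6 * 2 ^ m + 1 - -(6 * 2 ^ m) : ℤ)).toNat ≤ 2 ^ (m + 4) := by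
    have : (1 : ℤ) ≤ 2 ^ m := one_le_pow₀ (by norm_num)
    rw [Int.toNat_le]
    push_cast
    rw [pow_add]
    linarith
  rw [tubeParameters, Finset.card_product, Finset.card_product, Fintype.card_piFinset]
  simp only [Int.card_Icc, Finset.prod_const, Finset.card_univ, Fintype.card_fin]
  refine Nat.mul_le_mul_left _ ?_
  calc _ ≤ (2 ^ (m + 4)) ^ d * (2 ^ (m + 4)) ^ d := by gcongr
    _ = _ := by
      rw [← pow_mul, ← pow_add]
      congr 1
      ring

/-- A line can be parametrized by one of its coordinates in such a way that the other coordinates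
are `1`-Lipschitz functions of the parameter. -/
lemma IsLine.exists_parametrization {d : ℕ} {L : AffineSubspace ℝ (EuclideanSpace ℝ (Fin d))}
    (hL : IsLine L) : ∃ (i : Fin d) (u : Fin d → ℝ), (∀ j, |u j| ≤ 1) ∧
      ∀ y ∈ L, ∀ z ∈ L, ∀ j, y j - z j = (y i - z i) * u j := by
  obtain ⟨v, hv0, hv⟩ := finrank_eq_one_iff'.1 hL
  have hv0' : (v : EuclideanSpace ℝ (Fin d)) ≠ 0 := by simpa using hv0
  have hne : ∃ j, (v : EuclideanSpace ℝ (Fin d)) j ≠ 0 := by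
    by_contra! h
    exact hv0' (PiLp.ext h)
  obtain ⟨j₀, hj₀⟩ := hne
  have : Nonempty (Fin d) := ⟨j₀⟩
  obtain ⟨i, hi⟩ := Finite.exists_max fun j => |(v : EuclideanSpace ℝ (Fin d)) j|
  have hpos : 0 < |(v : EuclideanSpace ℝ (Fin d)) i| := (abs_pos.2 hj₀).trans_le (hi j₀)
  have hvi : (v : EuclideanSpace ℝ (Fin d)) i ≠ 0 := abs_pos.1 hpos
  refine ⟨i, fun j => (v : EuclideanSpace ℝ (Fin d)) j / (v : EuclideanSpace ℝ (Fin d)) i,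
    fun j => ?_, fun y hy z hz j => ?_⟩
  · rw [abs_div]
    exact (div_le_one hpos).2 (hi j)
  · obtain ⟨c, hc⟩ := hv ⟨y -ᵥ z, AffineSubspace.vsub_mem_direction hy hz⟩
    have hc' (l : Fin d) : c * (v : EuclideanSpace ℝ (Fin d)) l = y l - z l := by
      have := congrArg (fun w : L.direction => (w : EuclideanSpace ℝ (Fin d)) l) hc
      simpa using this
    rw [← hc', ← hc']
    field_simp

/-- Every tube of width at most `2 ^ (-m)` is covered, inside the unit cube, by the cubes of a
single discrete tube at scale `2 ^ (-m)`. -/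
lemma IsLine.exists_discreteTube {d : ℕ} {L : AffineSubspace ℝ (EuclideanSpace ℝ (Fin d))}
    (hL : IsLine L) {m : ℕ} {w : ℝ} (hw : w ≤ (1 / 2) ^ m) :
    ∃ p ∈ tubeParameters d m, ∀ k : Fin d → ℕ, (∀ j, k j < 2 ^ m) →
      (dyadicCube m k ∩ tube L w).Nonempty → k ∈ discreteTube m p.1 p.2.1 p.2.2 := by
  obtain ⟨i, u, hu, hpar⟩ := hL.exists_parametrization
  have hM : (1 : ℝ) ≤ 2 ^ m := one_le_pow₀ (by norm_num)
  have hM0 : (0 : ℝ) < 2 ^ m := by positivity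
  have htube : ∀ x ∈ tube L w, ∃ y ∈ L, ∀ j, |2 ^ m * x j - 2 ^ m * y j| ≤ 1 := by
    intro x hx
    obtain ⟨y, hy, hxy⟩ := Metric.mem_thickening_iff.1 hx
    refine ⟨y, hy, fun j => ?_⟩
    have h1 : |x j - y j| ≤ dist x y := by
      rw [dist_eq_norm]
      exact PiLp.norm_apply_le (x - y) j
    have h2 : |x j - y j| ≤ (2 ^ m)⁻¹ := by
      rw [one_div, inv_pow] at hw
      have : 0 < w / 2 := dist_nonneg.trans_lt hxy
      linarith
    rw [← mul_sub, abs_mul, abs_of_pos hM0]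
    calc _ ≤ (2 : ℝ) ^ m * (2 ^ m)⁻¹ := by gcongr
      _ = 1 := mul_inv_cancel₀ hM0.ne'
  have hcube : ∀ (k : Fin d → ℕ), ∀ x ∈ dyadicCube m k, ∀ j,
      (k j : ℝ) ≤ 2 ^ m * x j ∧ 2 ^ m * x j ≤ k j + 1 := by
    intro k x hx j
    have := hx j
    rw [div_le_iff₀ hM0, le_div_iff₀ hM0] at this
    rwa [mul_comm]
  by_cases hmeet : ∃ k₀ : Fin d → ℕ, (∀ j, k₀ j < 2 ^ m) ∧ (dyadicCube m k₀ ∩ tube L w).Nonempty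
  swap
  · push Not at hmeet
    refine ⟨(i, 0, 0), ?_, fun k hk hne => absurd hne (by simp [hmeet k hk])⟩
    simp [tubeParameters]
  obtain ⟨k₀, hk₀, x₀, hx₀, hx₀T⟩ := hmeet
  obtain ⟨y₀, hy₀, hxy₀⟩ := htube x₀ hx₀T
  -- `y₀` lies within distance `1` of the unit cube in every coordinate
  have hy₀_bd (j : Fin d) : -2 ^ m ≤ 2 ^ m * y₀ j ∧ 2 ^ m * y₀ j ≤ 2 * 2 ^ m := by
    have h1 := abs_le.1 (hxy₀ j)
    have h2 := hcube k₀ x₀ hx₀ j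
    have h3 : (k₀ j : ℝ) + 1 ≤ 2 ^ m := by exact_mod_cast hk₀ j
    have h4 : (0 : ℝ) ≤ k₀ j := Nat.cast_nonneg _
    constructor <;> linarith
  let A : Fin d → ℝ := fun j => 2 ^ m * y₀ j - 2 ^ m * y₀ i * u j
  let B : Fin d → ℝ := fun j => A j + 2 ^ m * u j
  have hmul (c : ℝ) (j : Fin d) : |c * u j| ≤ |c| := by
    rw [abs_mul]
    exact mul_le_of_le_one_right (abs_nonneg c) (hu j)
  have hA (j : Fin d) : -(4 * 2 ^ m) ≤ A j ∧ A j ≤ 4 * 2 ^ m := by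
    have h1 := hy₀_bd j
    have h3 : |2 ^ m * y₀ i| ≤ 2 * 2 ^ m := by
      rw [abs_le]
      constructor <;> linarith [hy₀_bd i]
    have h2 := (hmul (2 ^ m * y₀ i) j).trans h3
    rw [abs_le] at h2
    simp only [A]
    constructor <;> linarith
  have hB (j : Fin d) : -(5 * 2 ^ m) ≤ B j ∧ B j ≤ 5 * 2 ^ m := by
    have h1 := hA j
    have h2 := hmul (2 ^ m) j
    rw [abs_of_pos hM0, abs_le] at h2
    simp only [B]
    constructor <;> linarith
  have hfloor (z : ℝ) (h1 : -(5 * 2 ^ m) ≤ z) (h2 : z ≤ 5 * 2 ^ m) :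
      ⌊z⌋ ∈ Finset.Icc (-(6 * 2 ^ m) : ℤ) (6 * 2 ^ m) := by
    rw [Finset.mem_Icc, Int.le_floor]
    refine ⟨by push_cast; linarith, Int.floor_le_iff.2 (by push_cast; linarith)⟩
  refine ⟨(i, fun j => ⌊A j⌋, fun j => ⌊B j⌋), ?_, fun k hk hne => ?_⟩
  · simp only [tubeParameters, Finset.mem_product, Finset.mem_univ, true_and,
      Fintype.mem_piFinset]
    exact ⟨fun j => hfloor _ (by linarith [hA j]) (by linarith [hA j]),
      fun j => hfloor _ (hB j).1 (hB j).2⟩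
  · obtain ⟨x, hx, hxT⟩ := hne
    obtain ⟨y, hy, hxy⟩ := htube x hxT
    refine Finset.mem_filter.2 ⟨by simpa using hk, fun j => ?_⟩
    have hky (l : Fin d) : |(k l : ℝ) - 2 ^ m * y l| ≤ 2 := by
      have h1 := abs_le.1 (hxy l)
      have h2 := hcube k x hx l
      rw [abs_le]
      constructor <;> linarith
    have ht0 : (0 : ℝ) ≤ (k i : ℝ) / 2 ^ m := by positivity
    have ht1 : (k i : ℝ) / 2 ^ m ≤ 1 := by
      rw [div_le_one hM0]
      exact_mod_cast (hk i).le
    have hkt : (k i : ℝ) = k i / 2 ^ m * 2 ^ m := (div_mul_cancel₀ _ hM0.ne').symm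
    set t : ℝ := (k i : ℝ) / 2 ^ m
    have hyj : 2 ^ m * y j = A j + 2 ^ m * y i * u j := by
      have := hpar y hy y₀ hy₀ j
      simp only [A]
      linear_combination (2 : ℝ) ^ m * this
    have hsplit : (k j : ℝ) - (⌊A j⌋ + t * (⌊B j⌋ - ⌊A j⌋)) = (k j - 2 ^ m * y j) -
        (k i - 2 ^ m * y i) * u j + ((1 - t) * (A j - ⌊A j⌋) + t * (B j - ⌊B j⌋)) := by
      rw [hyj]
      simp only [B]
      linear_combination u j * hkt
    have h1 := abs_le.1 (hky j)
    have h2 := abs_le.1 ((hmul _ j).trans (hky i))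
    have h3 := Int.floor_le (A j)
    have h4 := Int.lt_floor_add_one (A j)
    have h5 := Int.floor_le (B j)
    have h6 := Int.lt_floor_add_one (B j)
    have h7 : 0 ≤ (1 - t) * (A j - ⌊A j⌋) := mul_nonneg (by linarith) (by linarith)
    have h8 : 0 ≤ t * (B j - ⌊B j⌋) := mul_nonneg ht0 (by linarith)
    have h9 : (1 - t) * (A j - ⌊A j⌋) ≤ 1 - t :=
      mul_le_of_le_one_right (by linarith) (by linarith)
    have h10 : t * (B j - ⌊B j⌋) ≤ t := mul_le_of_le_one_right ht0 (by linarith)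
    simp only [hsplit]
    rw [abs_le]
    constructor <;> linarith

/-! ### One step of the exponential moment estimate -/

instance cubeChoice_finite (d : ℕ) : Finite (CubeChoice d) :=
  inferInstanceAs (Finite {A : Finset (Fin d → Fin 2) // A.card = 2 ^ (d - 1)})

instance cubeChoice_discreteMeasurableSpace (d : ℕ) : DiscreteMeasurableSpace (CubeChoice d) :=
  ⟨fun _ => trivial⟩

section Measurability

variable {d : ℕ} {Ω : Type*} [MeasurableSpace Ω] {X : Ω → Selection d}

lemma measurableSet_retained_eq (hX : ∀ n k, Measurable fun ω => X ω n k) (n : ℕ)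
    (K : Finset (Fin d → ℕ)) : MeasurableSet {ω | retained (X ω) n = K} := by
  induction n generalizing K with
  | zero => exact MeasurableSet.const ({0} = K)
  | succ n ih =>
    let f (K' : Finset (Fin d → ℕ)) (c : K' → CubeChoice d) : Finset (Fin d → ℕ) :=
      Finset.univ.biUnion fun k : K' => (c k).1.image (childCube k.1)
    have hf (ω : Ω) : retained (X ω) (n + 1) =
        f (retained (X ω) n) fun k => X ω n k := by
      ext k
      simp [f, retained_succ]
    have : {ω | retained (X ω) (n + 1) = K} = ⋃ K', {ω | retained (X ω) n = K'} ∩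
        (fun ω (k : K') => X ω n k) ⁻¹' {c | f K' c = K} := by
      ext ω
      simp only [Set.mem_ofPred_eq, hf, Set.mem_iUnion, Set.mem_inter_iff, Set.mem_preimage]
      constructor
      · intro h
        exact ⟨_, rfl, h⟩
      · rintro ⟨K', rfl, h⟩
        exact h
    rw [this]
    refine MeasurableSet.iUnion fun K' => (ih K').inter ?_
    exact measurableSet_preimage (measurable_pi_lambda _ fun k => hX n k)
      (Set.Finite.measurableSet (Set.toFinite _))

lemma measurable_comp_retained {β : Type*} [MeasurableSpace β]
    (hX : ∀ n k, Measurable fun ω => X ω n k) (n : ℕ) (f : Finset (Fin d → ℕ) → β) :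
    Measurable fun ω => f (retained (X ω) n) := by
  intro s _
  have : (fun ω => f (retained (X ω) n)) ⁻¹' s =
      ⋃ K ∈ f ⁻¹' s, {ω | retained (X ω) n = K} := by
    ext ω; simp
  rw [this]
  exact MeasurableSet.biUnion (Set.to_countable _) fun K _ => measurableSet_retained_eq hX n K

end Measurability

/-- If every position belongs to a random choice `c` with probability `1 / 2`, then the total weight
`Z` of the chosen positions has mean `a`, half the weight of all positions, and `0 ≤ Z ≤ 2 * a`.
So `Z ^ 2 ≤ 2 * A * Z` for `a ≤ A`, and `exp x ≤ 1 + x + x ^ 2` bounds `exp (θ * Z)` by an affine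
function of `Z`, whose expectation depends on `a` only. -/
lemma lintegral_exp_choice_le {d : ℕ} {Ω : Type*} [MeasurableSpace Ω] {Q : Measure Ω}
    [IsProbabilityMeasure Q] {c : Ω → CubeChoice d} (hc : Measurable c)
    (hhalf : ∀ e, Q {ω | e ∈ (c ω).1} = 1 / 2) {w : (Fin d → Fin 2) → ℝ} (hw : ∀ e, 0 ≤ w e)
    {A θ : ℝ} (hA : (∑ e, w e) / 2 ≤ A) (hθ0 : 0 ≤ θ) (hθ : 2 * A * θ ≤ 1) :
    ∫⁻ ω, ENNReal.ofReal (Real.exp (θ * ∑ e ∈ (c ω).1, w e)) ∂Q ≤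
      ENNReal.ofReal (Real.exp (θ * (1 + 2 * A * θ) * ((∑ e, w e) / 2))) := by
  have hA0 : 0 ≤ A := (div_nonneg (Finset.sum_nonneg fun e _ => hw e) two_pos.le).trans hA
  set η := θ * (1 + 2 * A * θ) with hη
  have hη0 : 0 ≤ η := by positivity
  have hpoint (ω : Ω) : ENNReal.ofReal (Real.exp (θ * ∑ e ∈ (c ω).1, w e)) ≤
      1 + ∑ e, {ω | e ∈ (c ω).1}.indicator (fun _ => ENNReal.ofReal (η * w e)) ω := by
    set Z := ∑ e ∈ (c ω).1, w e with hZ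
    have hZ0 : 0 ≤ Z := Finset.sum_nonneg fun e _ => hw e
    have hZA : Z ≤ 2 * A := by
      have := Finset.sum_le_sum_of_subset_of_nonneg (Finset.subset_univ (c ω).1)
        fun e _ _ => hw e
      linarith
    have hθZ : θ * Z ≤ 2 * A * θ := by nlinarith
    have hexp : Real.exp (θ * Z) ≤ 1 + η * Z := by
      have h1 := (abs_le.1 (Real.abs_exp_sub_one_sub_id_le (x := θ * Z)
        (by rw [abs_of_nonneg (by positivity)]; linarith))).2
      have h2 : (θ * Z) ^ 2 ≤ 2 * A * θ * (θ * Z) := by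
        rw [sq]
        exact mul_le_mul_of_nonneg_right hθZ (by positivity)
      rw [hη]
      linarith
    refine (ENNReal.ofReal_le_ofReal hexp).trans (le_of_eq ?_)
    rw [ENNReal.ofReal_add zero_le_one (by positivity), ENNReal.ofReal_one, hZ, Finset.mul_sum,
      ENNReal.ofReal_sum_of_nonneg fun e _ => mul_nonneg hη0 (hw e)]
    congr 1
    rw [← Finset.sum_subset (Finset.subset_univ (c ω).1)]
    · refine Finset.sum_congr rfl fun e he => ?_
      rw [Set.indicator_of_mem (show ω ∈ {ω | e ∈ (c ω).1} from he)]
    · exact fun e _ he => Set.indicator_of_notMem (show ω ∉ {ω | e ∈ (c ω).1} from he) _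
  have hmeas (e : Fin d → Fin 2) : MeasurableSet {ω | e ∈ (c ω).1} :=
    hc (MeasurableSet.of_discrete (s := {a : CubeChoice d | e ∈ a.1}))
  calc _ ≤ ∫⁻ ω, 1 + ∑ e, {ω | e ∈ (c ω).1}.indicator (fun _ => ENNReal.ofReal (η * w e)) ω ∂Q :=
        lintegral_mono hpoint
    _ = 1 + ∑ e, ENNReal.ofReal (η * w e) * (1 / 2) := by
        rw [lintegral_add_left measurable_const, lintegral_const, measure_univ, mul_one,
          lintegral_finsetSum _ fun e _ => measurable_const.indicator (hmeas e)]
        congr 1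
        refine Finset.sum_congr rfl fun e _ => ?_
        rw [lintegral_indicator_const (hmeas e), hhalf]
    _ = ENNReal.ofReal (1 + η * ((∑ e, w e) / 2)) := by
        have hsum : 0 ≤ ∑ e, w e := Finset.sum_nonneg fun e _ => hw e
        rw [ENNReal.ofReal_add zero_le_one (by positivity), ENNReal.ofReal_one, ← Finset.sum_mul,
          ← ENNReal.ofReal_sum_of_nonneg fun e _ => mul_nonneg hη0 (hw e), ← Finset.mul_sum,
          ← mul_div_assoc η, ENNReal.ofReal_div_of_pos two_pos, one_div, div_eq_mul_inv,
          ENNReal.ofReal_ofNat]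
    _ ≤ _ := by
        refine ENNReal.ofReal_le_ofReal ?_
        linarith [Real.add_one_le_exp (η * ((∑ e, w e) / 2))]

/-- One step of the exponential moment estimate. The total weight of the retained cubes of level
`n + 1` is, given the retained cubes of level `n`, a sum of independent bounded terms, each with
mean half the weight of all children of a retained cube. -/
lemma IsRandomCantor.lintegral_exp_succ_le {d : ℕ} {Ω : Type*} [MeasurableSpace Ω] {P : Measure Ω}
    {X : Ω → Selection d} (hX : IsRandomCantor P X) (n : ℕ) {w : (Fin d → ℕ) → ℝ}
    (hw : ∀ k, 0 ≤ w k) {A θ : ℝ} (hA : ∀ k, (∑ e, w (childCube k e)) / 2 ≤ A) (hθ0 : 0 ≤ θ)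
    (hθ : 2 * A * θ ≤ 1) :
    ∫⁻ ω, ENNReal.ofReal (Real.exp (θ * ∑ k ∈ retained (X ω) (n + 1), w k)) ∂P ≤
      ∫⁻ ω, ENNReal.ofReal (Real.exp (θ * (1 + 2 * A * θ) *
        ∑ k ∈ retained (X ω) n, (∑ e, w (childCube k e)) / 2)) ∂P := by
  have := hX.isProbabilityMeasure
  have hG := measurableSet_retained_eq hX.measurable n
  have hunion : (⋃ K, {ω | retained (X ω) n = K}) = Set.univ := by
    ext ω; simp
  have hdisj : Pairwise (Function.onFun Disjoint fun K => {ω | retained (X ω) n = K}) := by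
    intro K K' hKK'
    rw [Function.onFun, Set.disjoint_left]
    rintro ω rfl h
    exact hKK' h
  have hdecomp (f : Ω → ℝ≥0∞) :
      ∫⁻ ω, f ω ∂P = ∑' K, ∫⁻ ω in {ω | retained (X ω) n = K}, f ω ∂P := by
    rw [← lintegral_iUnion hG hdisj, hunion, setLIntegral_univ]
  rw [hdecomp, hdecomp]
  refine ENNReal.tsum_le_tsum fun K => ?_
  by_cases hK : P {ω | retained (X ω) n = K} = 0
  · rw [setLIntegral_measure_zero _ _ hK]
    exact zero_le
  set G := {ω | retained (X ω) n = K} with hGdef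
  have hQ : IsProbabilityMeasure P[|G] := cond_isProbabilityMeasure hK
  let g : K → CubeChoice d → ℝ≥0∞ := fun k c =>
    ENNReal.ofReal (Real.exp (θ * ∑ e ∈ c.1, w (childCube k.1 e)))
  have hleft : ∫⁻ ω in G, ENNReal.ofReal (Real.exp (θ * ∑ k ∈ retained (X ω) (n + 1), w k)) ∂P =
      ∫⁻ ω in G, ∏ k : K, g k (X ω n k) ∂P := by
    refine setLIntegral_congr_fun (hG K) fun ω hω => ?_
    have hω' : retained (X ω) n = K := hω
    simp only [g]
    rw [sum_retained_succ, hω', ← ENNReal.ofReal_prod_of_nonneg fun k _ => (Real.exp_pos _).le,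
      ← Real.exp_sum, ← Finset.mul_sum,
      Finset.sum_coe_sort K fun k => ∑ e ∈ (X ω n k).1, w (childCube k e)]
  have hright : ∫⁻ ω in G, ENNReal.ofReal (Real.exp (θ * (1 + 2 * A * θ) *
        ∑ k ∈ retained (X ω) n, (∑ e, w (childCube k e)) / 2)) ∂P =
      P G * ∏ k : K, ENNReal.ofReal (Real.exp (θ * (1 + 2 * A * θ) *
        ((∑ e, w (childCube k.1 e)) / 2))) := by
    rw [mul_comm (P G), ← setLIntegral_const]
    refine setLIntegral_congr_fun (hG K) fun ω hω => ?_
    have hω' : retained (X ω) n = K := hω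
    rw [hω', ← ENNReal.ofReal_prod_of_nonneg fun k _ => (Real.exp_pos _).le,
      ← Real.exp_sum, ← Finset.mul_sum,
      Finset.sum_coe_sort K fun k => (∑ e, w (childCube k e)) / 2]
  rw [hleft, hright, ← ENNReal.inv_mul_le_iff hK (measure_ne_top P G), ← smul_eq_mul,
    ← lintegral_smul_measure]
  change ∫⁻ ω, ∏ k : K, g k (X ω n k) ∂P[|G] ≤ _
  rw [lintegral_prod_eq_prod_lintegral_of_indepFun Finset.univ (fun (k : K) ω => g k (X ω n k))
    ((hX.indep n K hK).comp g fun k => Measurable.of_discrete)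
    fun k => (Measurable.of_discrete (f := g k)).comp (hX.measurable n k)]
  exact Finset.prod_le_prod' fun k _ => lintegral_exp_choice_le (hX.measurable n k)
    (hX.marginal n K hK k k.2) (fun e => hw _) (hA k) hθ0 hθ

/-! ### Retained cubes in discrete tubes -/

lemma card_filter_ancestor_succ {d : ℕ} (F : Finset (Fin d → ℕ)) (j : ℕ) (k : Fin d → ℕ) :
    (F.filter fun f => ancestor (j + 1) f = k).card =
      ∑ e, (F.filter fun f => ancestor j f = childCube k e).card := by
  simp only [Finset.card_filter]
  rw [Finset.sum_comm]
  refine Finset.sum_congr rfl fun f _ => ?_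
  obtain ⟨l, e₀, hl⟩ : ∃ l e₀, ancestor j f = childCube l e₀ := ⟨_, exists_childCube_eq _⟩
  rw [ancestor_succ]
  simp only [hl, ancestor_one_childCube, childCube_inj_iff, ite_and]
  by_cases h : l = k <;> simp [h]

/-- Let `F` be a set of cubes of level `m` that is at most one-dimensional, in the sense that a cube
of level `m - j` contains at most `B * 2 ^ j` of them. Then the number of retained cubes in `F` has
an exponential moment of order `1 / (m + 1)`. The proof propagates the bound
`E exp (Y_n / (2 * B * (n + 1))) ≤ exp (1 / 2)` from `n` to `n + 1`, where `Y_n` is the conditional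
expectation of the number of retained cubes in `F` given the `n`-th stage. -/
lemma IsRandomCantor.lintegral_exp_card_le {d : ℕ} {Ω : Type*} [MeasurableSpace Ω] {P : Measure Ω}
    {X : Ω → Selection d} (hX : IsRandomCantor P X) {m B : ℕ} (hB : 0 < B)
    {F : Finset (Fin d → ℕ)}
    (hF : ∀ j k, (F.filter fun f => ancestor j f = k).card ≤ B * 2 ^ j) :
    ∫⁻ ω, ENNReal.ofReal (Real.exp (1 / (2 * B * (m + 1)) * (F ∩ retained (X ω) m).card)) ∂P ≤
      ENNReal.ofReal (Real.exp (1 / 2)) := by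
  have := hX.isProbabilityMeasure
  have hB' : (0 : ℝ) < B := by exact_mod_cast hB
  let W : ℕ → (Fin d → ℕ) → ℝ := fun n k =>
    2 ^ n / 2 ^ m * (F.filter fun f => ancestor (m - n) f = k).card
  have hW0 (n : ℕ) (k : Fin d → ℕ) : 0 ≤ W n k := by positivity
  have hWB (n : ℕ) (hn : n ≤ m) (k : Fin d → ℕ) : W n k ≤ B := by
    calc W n k ≤ 2 ^ n / 2 ^ m * (B * 2 ^ (m - n)) := by
          simp only [W]
          gcongr
          exact_mod_cast hF (m - n) k
      _ = B * (2 ^ n * 2 ^ (m - n)) / 2 ^ m := by ring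
      _ = B := by
          rw [← pow_add, Nat.add_sub_cancel' hn]
          field_simp
  have hWsucc (n : ℕ) (hn : n + 1 ≤ m) (k : Fin d → ℕ) :
      (∑ e, W (n + 1) (childCube k e)) / 2 = W n k := by
    have hj : m - n = m - (n + 1) + 1 := by omega
    simp only [W]
    rw [← Finset.mul_sum, hj, card_filter_ancestor_succ, pow_succ]
    push_cast
    ring
  have key (n : ℕ) (hn : n ≤ m) :
      ∫⁻ ω, ENNReal.ofReal (Real.exp (1 / (2 * B * (n + 1)) *
        ∑ k ∈ retained (X ω) n, W n k)) ∂P ≤ ENNReal.ofReal (Real.exp (1 / 2)) := by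
    induction n with
    | zero =>
      refine (lintegral_mono (g := fun _ => ENNReal.ofReal (Real.exp (1 / 2))) fun ω => ?_).trans
        (by simp)
      refine ENNReal.ofReal_le_ofReal (Real.exp_le_exp.2 ?_)
      simp only [retained, Finset.sum_singleton]
      calc _ ≤ 1 / (2 * (B : ℝ) * ((0 : ℕ) + 1)) * B := by
            gcongr
            exact hWB 0 hn 0
        _ = 1 / 2 := by
            push_cast
            field_simp
            norm_num
    | succ n ih =>
      refine le_trans ?_ (ih (by omega))
      refine (hX.lintegral_exp_succ_le n (w := W (n + 1)) (hW0 _) (A := B)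
        (fun k => (hWsucc n hn k).trans_le (hWB n (by omega) k)) (by positivity) ?_).trans ?_
      · push_cast
        rw [mul_one_div, div_le_one (by positivity)]
        nlinarith [(Nat.cast_nonneg n : (0 : ℝ) ≤ n)]
      · refine lintegral_mono fun ω => ENNReal.ofReal_le_ofReal (Real.exp_le_exp.2 ?_)
        simp only [hWsucc n hn]
        refine mul_le_mul_of_nonneg_right ?_ (Finset.sum_nonneg fun k _ => hW0 n k)
        -- with `x = n + 2` this is `(1 + 1 / x) / x ≤ 1 / (x - 1)`
        have hx : (0 : ℝ) ≤ n := Nat.cast_nonneg n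
        have e : 1 / (2 * (B : ℝ) * ((n + 1 : ℕ) + 1)) *
            (1 + 2 * B * (1 / (2 * (B : ℝ) * ((n + 1 : ℕ) + 1)))) =
            (n + 3) / (n + 2) ^ 2 / (2 * B) := by
          push_cast
          field_simp
          ring
        rw [e, div_div, div_le_div_iff₀ (by positivity) (by positivity)]
        nlinarith [mul_pos hB' hB']
  refine le_of_eq_of_le ?_ (key m le_rfl)
  have hWm (K : Finset (Fin d → ℕ)) : ∑ k ∈ K, W m k = (F ∩ K).card := by
    have h1 (k : Fin d → ℕ) : W m k = if k ∈ F then 1 else 0 := by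
      simp only [W, Nat.sub_self, ancestor_zero, Finset.filter_eq']
      rw [div_self (by positivity), one_mul]
      split_ifs <;> simp
    simp only [h1, Finset.sum_boole, Finset.inter_comm F, ← Finset.filter_mem_eq_inter]
  simp only [hWm]

lemma IsRandomCantor.measure_card_discreteTube_ge_le {d : ℕ} {Ω : Type*} [MeasurableSpace Ω]
    {P : Measure Ω} {X : Ω → Selection d} (hX : IsRandomCantor P X) (m : ℕ) (i : Fin d)
    (a b : Fin d → ℤ) (c : ℕ) :
    P {ω | 2 * 11 ^ d * c * (m + 1) ^ 2 ≤ (discreteTube m i a b ∩ retained (X ω) m).card} ≤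
      ENNReal.ofReal (2 * (1 / 2) ^ (c * (m + 1))) := by
  have hmean := hX.lintegral_exp_card_le (m := m) (B := 11 ^ d) (by positivity)
    (F := discreteTube m i a b) fun j k => card_filter_discreteTube_le m j i a b k
  set f : Ω → ℝ≥0∞ := fun ω => ENNReal.ofReal (Real.exp (1 / (2 * (11 ^ d : ℕ) * (m + 1)) *
    (discreteTube m i a b ∩ retained (X ω) m).card)) with hf
  have hmeas : Measurable f := measurable_comp_retained hX.measurable m fun K =>
    ENNReal.ofReal (Real.exp (1 / (2 * (11 ^ d : ℕ) * (m + 1)) * (discreteTube m i a b ∩ K).card))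
  set t : ℝ := Real.exp (c * (m + 1)) with ht
  have ht0 : 0 < t := Real.exp_pos _
  have hsub : {ω | 2 * 11 ^ d * c * (m + 1) ^ 2 ≤
      (discreteTube m i a b ∩ retained (X ω) m).card} ⊆ {ω | ENNReal.ofReal t ≤ f ω} := by
    intro ω hω
    have hω' : (2 * 11 ^ d * c * (m + 1) ^ 2 : ℝ) ≤
        (discreteTube m i a b ∩ retained (X ω) m).card := by exact_mod_cast hω
    refine ENNReal.ofReal_le_ofReal (Real.exp_le_exp.2 ?_)
    rw [one_div, inv_mul_eq_div, le_div_iff₀ (by positivity)]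
    push_cast
    linarith
  have h2 : Real.exp (1 / 2) / t ≤ 2 * (1 / 2) ^ (c * (m + 1)) := by
    have he := Real.add_one_le_exp 1
    have e1 : Real.exp (1 / 2) ≤ 2 := by
      have h : Real.exp (1 / 2) ^ 2 ≤ 2 ^ 2 := by
        rw [← Real.exp_nat_mul]
        norm_num
        linarith [Real.exp_one_lt_d9]
      exact le_of_sq_le_sq h (by norm_num)
    have e2 : (2 : ℝ) ^ (c * (m + 1)) ≤ t := by
      rw [ht, show ((c : ℝ) * (m + 1)) = ((c * (m + 1) : ℕ) : ℝ) * 1 by push_cast; ring,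
        Real.exp_nat_mul]
      gcongr
      linarith
    rw [one_div (2 : ℝ), inv_pow, ← div_eq_mul_inv 2]
    rw [one_div] at e1
    gcongr
  calc _ ≤ P {ω | ENNReal.ofReal t ≤ f ω} := measure_mono hsub
    _ ≤ (∫⁻ ω, f ω ∂P) / ENNReal.ofReal t :=
        meas_ge_le_lintegral_div hmeas.aemeasurable (by simpa using ht0) ENNReal.ofReal_ne_top
    _ ≤ ENNReal.ofReal (Real.exp (1 / 2)) / ENNReal.ofReal t := by gcongr
    _ ≤ _ := by
        rw [← ENNReal.ofReal_div_of_pos ht0]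
        exact ENNReal.ofReal_le_ofReal h2

/-- Almost surely, at every fine scale `2 ^ (-m)` every discrete tube contains `O (m ^ 2)` retained
cubes. -/
lemma IsRandomCantor.ae_eventually_card_discreteTube_lt {d : ℕ} {Ω : Type*} [MeasurableSpace Ω]
    {P : Measure Ω} {X : Ω → Selection d} (hX : IsRandomCantor P X) :
    ∀ᵐ ω ∂P, ∀ᶠ m in Filter.atTop, ∀ p ∈ tubeParameters d m,
      (discreteTube m p.1 p.2.1 p.2.2 ∩ retained (X ω) m).card <
        2 * 11 ^ d * (8 * d + 1) * (m + 1) ^ 2 := by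
  let bad : ℕ → Set Ω := fun m => ⋃ p ∈ tubeParameters d m,
    {ω | 2 * 11 ^ d * (8 * d + 1) * (m + 1) ^ 2 ≤
      (discreteTube m p.1 p.2.1 p.2.2 ∩ retained (X ω) m).card}
  have hbad (m : ℕ) : P (bad m) ≤ ENNReal.ofReal (2 * d * (1 / 2) ^ m) := by
    refine (measure_biUnion_finset_le _ _).trans ((Finset.sum_le_sum fun p _ =>
      hX.measure_card_discreteTube_ge_le m p.1 p.2.1 p.2.2 (8 * d + 1)).trans ?_)
    rw [Finset.sum_const, nsmul_eq_mul, ← ENNReal.ofReal_natCast,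
      ← ENNReal.ofReal_mul (by positivity)]
    refine ENNReal.ofReal_le_ofReal ?_
    have hcard : ((tubeParameters d m).card : ℝ) ≤ d * 2 ^ (8 * d * (m + 1)) := by
      refine le_trans (b := (d : ℝ) * 2 ^ (2 * d * (m + 4)))
        (by exact_mod_cast card_tubeParameters_le d m) ?_
      refine mul_le_mul_of_nonneg_left (pow_le_pow_right₀ one_le_two ?_) (Nat.cast_nonneg d)
      nlinarith
    have e : (1 / 2 : ℝ) ^ ((8 * d + 1) * (m + 1)) =
        (2 ^ (8 * d * (m + 1)))⁻¹ * ((1 / 2) ^ m * (1 / 2)) := by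
      rw [add_mul, one_mul, pow_add, pow_succ _ m, one_div, inv_pow]
    calc _ ≤ (d : ℝ) * 2 ^ (8 * d * (m + 1)) * (2 * (1 / 2) ^ ((8 * d + 1) * (m + 1))) := by gcongr
      _ = d * (1 / 2) ^ m := by
          rw [e]
          field_simp
      _ ≤ _ := by
          have : (0 : ℝ) ≤ d * (1 / 2) ^ m := by positivity
          linarith
  have hsum : ∑' m, P (bad m) ≠ ⊤ := by
    refine ne_top_of_le_ne_top ?_ (ENNReal.tsum_le_tsum hbad)
    rw [← ENNReal.ofReal_tsum_of_nonneg (fun m => by positivity)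
      ((summable_geometric_of_lt_one (by norm_num) (by norm_num)).mul_left _)]
    exact ENNReal.ofReal_ne_top
  filter_upwards [ae_eventually_notMem hsum] with ω hω
  filter_upwards [hω] with m hm p hp
  by_contra! h
  exact hm (Set.mem_biUnion hp h)

/-! ### The tube estimate -/

lemma card_retainedMeeting_tube_le {d : ℕ} {S : Selection d} {m c : ℕ}
    (h : ∀ p ∈ tubeParameters d m, (discreteTube m p.1 p.2.1 p.2.2 ∩ retained S m).card ≤ c)
    {L : AffineSubspace ℝ (EuclideanSpace ℝ (Fin d))} (hL : IsLine L) {w : ℝ}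
    (hw : w ≤ (1 / 2) ^ m) : (retainedMeeting S m (tube L w)).card ≤ c := by
  obtain ⟨p, hp, hpk⟩ := hL.exists_discreteTube hw
  refine (Finset.card_le_card fun k hk => ?_).trans (h p hp)
  obtain ⟨hk1, hk2⟩ := mem_retainedMeeting.1 hk
  exact Finset.mem_inter.2 ⟨hpk k (lt_of_mem_retained hk1) hk2, hk1⟩

/-- If a tube of width about `2 ^ (-m)` meets `O(m ^ 2)` retained cubes of level `m`, then the tube
estimate holds for every exponent `t < d - 1`: the factor `(m + 1) ^ 2` is absorbed by
`2 ^ (-(d - 1 - t) * m)`. -/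
lemma tubeSup_lt_top_of_card_le {d : ℕ} (hd : 2 ≤ d) {S : Selection d} {C : ℕ}
    (hC : ∀ᶠ m in Filter.atTop, ∀ p ∈ tubeParameters d m,
      (discreteTube m p.1 p.2.1 p.2.2 ∩ retained S m).card < C * (m + 1) ^ 2)
    {t : ℝ} (ht0 : 0 ≤ t) (ht : t < (d : ℝ) - 1) :
    tubeSup ((d : ℝ) - 1) t (limitCantorSet S) < ⊤ := by
  have hcast : (d : ℝ) - 1 = ((d - 1 : ℕ) : ℝ) := by
    rw [Nat.cast_sub (by omega), Nat.cast_one]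
  rw [hcast] at ht ⊢
  set q := d - 1 with hq
  obtain ⟨M, hM⟩ := Filter.eventually_atTop.1 hC
  set K : ℕ := C + (2 ^ q) ^ M with hK
  have hcard (m : ℕ) : ∀ p ∈ tubeParameters d m,
      (discreteTube m p.1 p.2.1 p.2.2 ∩ retained S m).card ≤ K * (m + 1) ^ 2 := by
    intro p hp
    rcases le_total M m with h | h
    · refine (hM m h p hp).le.trans ?_
      gcongr
      exact Nat.le_add_right _ _
    · calc _ ≤ (retained S m).card := Finset.card_le_card Finset.inter_subset_right
        _ ≤ (2 ^ q) ^ M := by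
            rw [card_retained]
            exact Nat.pow_le_pow_right (by positivity) h
        _ ≤ K := Nat.le_add_left _ _
        _ ≤ _ := Nat.le_mul_of_pos_right _ (by positivity)
  set ρ : ℝ := (1 / 2) ^ (q - t) with hρ
  have hρ0 : 0 < ρ := Real.rpow_pos_of_pos (by norm_num) _
  have hρ1 : ρ < 1 := Real.rpow_lt_one (by norm_num) (by norm_num) (by linarith)
  obtain ⟨D, hD⟩ := (tendsto_pow_const_mul_const_pow_of_abs_lt_one 2
    (by rwa [abs_of_pos hρ0] : |ρ| < 1)).bddAbove_range
  have hD' (m : ℕ) : ((m : ℝ) + 1) ^ 2 * ρ ^ (m + 1) ≤ D := by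
    have := hD (Set.mem_range_self (m + 1))
    push_cast at this
    exact this
  refine lt_of_le_of_lt (b := μH[(q : ℝ)] (limitCantorSet S) +
    ENNReal.ofReal (K * d ^ q * 2 ^ q * D)) ?_
    (ENNReal.add_lt_top.2 ⟨hausdorffMeasure_limitCantorSet_lt_top S, ENNReal.ofReal_lt_top⟩)
  refine iSup₂_le fun L hL => iSup₂_le fun w hw => ?_
  have hwt : 0 < w ^ t := Real.rpow_pos_of_pos hw t
  rcases le_or_gt 1 w with h1 | h1
  · refine le_trans ?_ le_self_add
    refine (ENNReal.div_le_of_le_mul ?_)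
    refine (measure_mono Set.inter_subset_left).trans (le_mul_of_one_le_right (zero_le) ?_)
    rw [← ENNReal.ofReal_one]
    exact ENNReal.ofReal_le_ofReal (Real.one_le_rpow h1 ht0)
  · refine le_trans ?_ le_add_self
    obtain ⟨m, hm1, hm2⟩ := exists_nat_pow_near_of_lt_one hw h1.le (y := (1 / 2 : ℝ)) (by norm_num)
      (by norm_num)
    refine ENNReal.div_le_of_le_mul ?_
    rw [← ENNReal.ofReal_mul' hwt.le]
    refine (hausdorffMeasure_inter_le S m _).trans (ENNReal.ofReal_le_ofReal ?_)
    have hc := card_retainedMeeting_tube_le (hcard m) hL hm2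
    set x : ℝ := (1 / 2) ^ (m + 1) with hx
    have hx0 : 0 < x := by positivity
    have hxq : x ^ q = x ^ t * ρ ^ (m + 1) := by
      rw [hρ, hx, ← Real.rpow_natCast ((1 / 2 : ℝ) ^ ((q : ℝ) - t)), ← Real.rpow_mul (by norm_num),
        mul_comm ((q : ℝ) - t), Real.rpow_mul (by norm_num), Real.rpow_natCast,
        ← Real.rpow_add (by positivity), ← Real.rpow_natCast _ q]
      congr 1
      ring
    have hxm : (d : ℝ) / 2 ^ m = d * 2 * x := by
      rw [hx, pow_succ, one_div, inv_pow]
      field_simp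
    have hxw : x ^ t ≤ w ^ t := Real.rpow_le_rpow hx0.le hm1.le ht0
    calc _ ≤ (K * ((m : ℝ) + 1) ^ 2) * (d * 2 * x) ^ q := by
          rw [hxm]
          gcongr
          exact_mod_cast hc
      _ = K * d ^ q * 2 ^ q * (((m : ℝ) + 1) ^ 2 * ρ ^ (m + 1)) * x ^ t := by
          rw [mul_pow, mul_pow, hxq]
          ring
      _ ≤ K * d ^ q * 2 ^ q * D * w ^ t := by
          have hD0 : 0 ≤ D := le_trans (by positivity) (hD' 0)
          gcongr
          exact hD' m

theorem IsRandomCantor.ae_isTubeBounded {d : ℕ} (hd : 2 ≤ d) {Ω : Type*} [MeasurableSpace Ω]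
    {P : Measure Ω} {X : Ω → Selection d} (hX : IsRandomCantor P X) :
    ∀ᵐ ω ∂P, IsTubeBounded (limitCantorSet (X ω)) := by
  have hcast : (d : ℝ) - 1 = ((d - 1 : ℕ) : ℝ) := by
    rw [Nat.cast_sub (by omega), Nat.cast_one]
  filter_upwards [hX.ae_eventually_card_discreteTube_lt] with ω hω
  exact
    { isCompact := isCompact_limitCantorSet _
      ahlfors := isAhlforsRegular_limitCantorSet hd _
      hausdorff_pos := hcast ▸ hausdorffMeasure_limitCantorSet_pos hd _
      hausdorff_lt_top := hcast ▸ hausdorffMeasure_limitCantorSet_lt_top _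
      tubeSup_lt_top := fun t ht0 ht => tubeSup_lt_top_of_card_le hd hω ht0 ht }

/-! ### Existence of random Cantor sets -/

lemma cubeChoice_nonempty (d : ℕ) : Nonempty (CubeChoice d) := by
  obtain ⟨A, -, hA⟩ := Finset.exists_subset_card_eq (s := (Finset.univ : Finset (Fin d → Fin 2)))
    (n := 2 ^ (d - 1)) (by simpa using Nat.pow_le_pow_right two_pos (Nat.sub_le d 1))
  exact ⟨⟨A, hA⟩⟩

/-- The uniform law on the choices of half of the children. -/
noncomputable def uniformChoice (d : ℕ) : Measure (CubeChoice d) := uniformOn Set.univ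

instance isProbabilityMeasure_uniformChoice (d : ℕ) : IsProbabilityMeasure (uniformChoice d) :=
  have := cubeChoice_nonempty d
  isProbabilityMeasure_uniformOn Set.finite_univ Set.univ_nonempty

/-- Complementation is a bijection between the choices that contain `e` and those that do not. -/
lemma uniformChoice_mem {d : ℕ} (hd : 1 ≤ d) (e : Fin d → Fin 2) :
    uniformChoice d {c | e ∈ c.1} = 1 / 2 := by
  let σ : CubeChoice d → CubeChoice d := fun c => ⟨c.1ᶜ, by
    rw [Finset.card_compl, c.2]
    obtain ⟨n, rfl⟩ := Nat.exists_eq_add_of_le' hd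
    simp [pow_succ]
    omega⟩
  have hσ : Function.Injective σ := fun c c' h =>
    Subtype.ext (compl_injective (Subtype.mk.inj h))
  have hσσ (c : CubeChoice d) : σ (σ c) = c := Subtype.ext (compl_compl _)
  have himage : σ '' {c | e ∈ c.1} = {c | e ∈ c.1}ᶜ := by
    ext c
    constructor
    · rintro ⟨c', hc', rfl⟩ h
      exact Finset.mem_compl.1 h hc'
    · intro hc
      exact ⟨σ c, Finset.mem_compl.2 hc, hσσ c⟩
  have hcompl : uniformChoice d {c | e ∈ c.1}ᶜ = uniformChoice d {c | e ∈ c.1} := by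
    simp only [uniformChoice, uniformOn, cond_apply MeasurableSet.univ, Set.univ_inter]
    rw [← himage, Measure.count_injective_image hσ]
  have h := prob_add_prob_compl (μ := uniformChoice d)
    (MeasurableSet.of_discrete (s := {c : CubeChoice d | e ∈ c.1}))
  rw [hcompl, ← two_mul] at h
  rw [one_div]
  exact ENNReal.eq_inv_of_mul_eq_one_left (by rwa [mul_comm])

/-- The law of a selection in which the choices at all cubes are independent and uniform. The
product is taken first over the cubes of a level and then over the levels. -/
noncomputable def independentSelection (d : ℕ) : Measure (Selection d) :=
  Measure.infinitePi fun _ => Measure.infinitePi fun _ => uniformChoice d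

lemma retained_congr {d : ℕ} {S S' : Selection d} {n : ℕ} (h : ∀ i < n, S i = S' i) :
    retained S n = retained S' n := by
  induction n with
  | zero => rfl
  | succ n ih => rw [retained_succ, retained_succ, ih fun i hi => h i (by omega), h n (by omega)]

/-- The choices at level `n` are independent of the retained cubes of level `n`, because these are
determined by the choices at the lower levels. -/
lemma indepFun_retained_eval (d n : ℕ) (K : Finset (Fin d → ℕ))
    {B : Set ((Fin d → ℕ) → CubeChoice d)} (hB : MeasurableSet B) :
    independentSelection d ({S | retained S n = K} ∩ {S | S n ∈ B}) =
      independentSelection d {S | retained S n = K} * independentSelection d {S | S n ∈ B} := by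
  have hind : iIndepFun (fun (n : ℕ) (S : Selection d) => S n) (independentSelection d) :=
    iIndepFun_infinitePi (X := fun _ f => f) fun _ => measurable_id
  have h := hind.indepFun_finset (Finset.range n) {n} (by simp) fun i => measurable_pi_apply i
  obtain ⟨c₀⟩ := cubeChoice_nonempty d
  let ψ : (Finset.range n → (Fin d → ℕ) → CubeChoice d) → Selection d := fun f i k =>
    if hi : i ∈ Finset.range n then f ⟨i, hi⟩ k else c₀
  have hψ (i : ℕ) (k : Fin d → ℕ) : Measurable fun f => ψ f i k := by
    by_cases hi : i ∈ Finset.range n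
    · simp only [ψ, hi, dif_pos]
      fun_prop
    · simp only [ψ, hi, dif_neg, not_false_eq_true]
      exact measurable_const
  have h1 : {S : Selection d | retained S n = K} =
      (fun (S : Selection d) (i : Finset.range n) => S i) ⁻¹' {f | retained (ψ f) n = K} := by
    ext S
    have : retained (ψ fun i : Finset.range n => S i) n = retained S n :=
      retained_congr fun i hi => by
        funext k
        simp [ψ, hi]
    simp [this]
  have h2 : {S : Selection d | S n ∈ B} =
      (fun (S : Selection d) (i : ({n} : Finset ℕ)) => S i) ⁻¹'
        {f | f ⟨n, Finset.mem_singleton_self n⟩ ∈ B} := rfl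
  rw [h1, h2]
  exact h.measure_inter_preimage_eq_mul _ _ (measurableSet_retained_eq hψ n K)
    (measurable_pi_apply _ hB)

lemma isRandomCantor_independentSelection {d : ℕ} (hd : 1 ≤ d) :
    IsRandomCantor (independentSelection d) fun S => S := by
  have hP : IsProbabilityMeasure (independentSelection d) := by
    unfold independentSelection
    infer_instance
  have hmeas (n : ℕ) (k : Fin d → ℕ) : Measurable fun S : Selection d => S n k :=
    (measurable_pi_apply k).comp (measurable_pi_apply n)
  have hlaw (n : ℕ) (K : Finset (Fin d → ℕ))
      (hK : independentSelection d {S | retained S n = K} ≠ 0) :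
      (independentSelection d)[|{S | retained S n = K}].map (fun S => S n) =
        Measure.infinitePi fun _ => uniformChoice d := by
    ext B hB
    rw [Measure.map_apply (measurable_pi_apply n) hB,
      cond_apply (measurableSet_retained_eq hmeas n K)]
    change _ * independentSelection d ({S | retained S n = K} ∩ {S | S n ∈ B}) = _
    rw [indepFun_retained_eval d n K hB, ← mul_assoc,
      ENNReal.inv_mul_cancel hK (measure_ne_top _ _), one_mul]
    rw [← Measure.infinitePi_map_eval (fun _ : ℕ => Measure.infinitePi fun _ : Fin d → ℕ =>
      uniformChoice d) n, Measure.map_apply (measurable_pi_apply n) hB]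
    rfl
  have hlaw' (n : ℕ) (K : Finset (Fin d → ℕ))
      (hK : independentSelection d {S | retained S n = K} ≠ 0) (k : Fin d → ℕ) :
      (independentSelection d)[|{S | retained S n = K}].map (fun S => S n k) =
        uniformChoice d := by
    rw [← Measure.infinitePi_map_eval (fun _ : Fin d → ℕ => uniformChoice d) k, ← hlaw n K hK,
      Measure.map_map (measurable_pi_apply k) (measurable_pi_apply n)]
    rfl
  refine ⟨hP, hmeas, fun n K hK => ?_, fun n K hK k _ e => ?_⟩
  · have := cond_isProbabilityMeasure hK
    rw [iIndepFun_iff_map_fun_eq_infinitePi_map fun k : K => hmeas n k]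
    simp only [hlaw' n K hK]
    rw [← Measure.map_infinitePi_infinitePi_of_inj (P := fun _ : Fin d → ℕ => uniformChoice d)
      (f := fun k : K => (k : Fin d → ℕ)) Subtype.val_injective, ← hlaw n K hK,
      Measure.map_map (g := fun (f : (Fin d → ℕ) → CubeChoice d) (k : K) => f k) (by fun_prop)
        (measurable_pi_apply n)]
    rfl
  · rw [← uniformChoice_mem hd e, ← hlaw' n K hK k,
      Measure.map_apply (hmeas n k) MeasurableSet.of_discrete]
    rfl

/-! ### Conclusion -/

theorem theorem1p1 (d : ℕ) (hd : 2 ≤ d) :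
    (∃ E : Set (EuclideanSpace ℝ (Fin d)), IsTubeBounded E ∧
      ∃ (Ω : Type) (_ : MeasurableSpace Ω) (P : Measure Ω) (X : Ω → Selection d),
        IsRandomCantor P X ∧ ∃ ω, E = limitCantorSet (X ω)) ∧
    (∀ (Ω : Type*) [MeasurableSpace Ω] (P : Measure Ω) (X : Ω → Selection d),
      IsRandomCantor P X → ∀ᵐ ω ∂P, IsTubeBounded (limitCantorSet (X ω))) := by
  refine ⟨?_, fun Ω _ P X hX => hX.ae_isTubeBounded hd⟩
  have hX := isRandomCantor_independentSelection (d := d) (by omega)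
  have := hX.isProbabilityMeasure
  obtain ⟨S, hS⟩ := (hX.ae_isTubeBounded hd).exists
  exact ⟨_, hS, _, _, _, _, hX, S, rfl⟩
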